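/- **Setting.** Let $N$ be a finite set of agents, $A\subseteq N$, $D=N\setminus A$, and let $X\subseteq\mathbb R$ be a nonempty set of alternatives. A preference $R_i$ on $X$ is a complete, transitive, antisymmetric relation, with strict part $P_i$. It is single-peaked if there is $\rho\in X$ such that $x\,P_i\,y$ whenever $\rho\ge x>y$ or $\rho\le x<y$, and single-dipped if there is $\delta\in X$ such that $y\,P_i\,x$ whenever $\delta\ge x>y$ or $\delta\le x<y$. Let $\mathcal R$ be the set of profiles $R=(R_i)_{i\in N}$ in which each agent of $A$ has a single-peaked and each agent of $D$ a single-dipped preference. Let $f:\mathcal R\to X$ be a rule whose range $\Omega$ is closed in $\mathbb R$. The rule $f$ is *strategy-proof* if $f(R)\,R_i\,f(R_i',R_{-i})$ always holds; *group strategy-proof* if for all $R$, all nonempty $S\subseteq N$ and all $R'_S$ there is $i\in S$ with $f(R)\,R_i\,f(R'_S,R_{-S})$; *type-anonymous* if $f(R)=f(R_\sigma)$ for every permutation $\sigma$ of $N$ with $\sigma(A)=A$, where $(R_\sigma)_i=R_{\sigma(i)}$. For $i\in A$ let $p(R_i)$ be the most preferred element of $\Omega$ at $R_i$, and $p(R)=(p(R_i))_{i\in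 A}$. Let $\Omega^2_C$ be the set of pairs $(x,y)\in\Omega\times\Omega$ with $x<y$ and no element of $\Omega$ strictly between $x$ and $y$. Order $\Omega\cup\Omega^2_C$ linearly by $\le^*$, which extends $\le$ on $\Omega$ and satisfies $x<^*(x,y)<^*y$ for $(x,y)\in\Omega^2_C$. A set $r_\omega$ is *admissible* if $\Omega\setminus\{\min\Omega,\max\Omega\}\subseteq r_\omega\subseteq\Omega\cup\Omega^2_C$; if $\min\Omega$ exists, then $\min\Omega\in r_\omega$ or the pair of $\Omega^2_C$ with left member $\min\Omega$ exists and belongs to $r_\omega$; and, if $\max\Omega$ exists, then $\max\Omega\in r_\omega$ or the pair of $\Omega^2_C$ with right member $\max\Omega$ exists and belongs to $r_\omega$. A *type-anonymous left coalition system* on $r_\omega$ assigns to each $\alpha\in r_\omega$ a collection $\mathcal L(\alpha)$ of subsets of $A$ such that 1. if $S\in\mathcal L(\alpha)$ and $S\subseteq S'\subseteq A$, then $S'\in\mathcal L(\alpha)$; 2. if $\alpha<^*\beta$, then $\mathcal L(\alpha)\subseteq\mathcal L(\beta)$; 3. if $\max\Omega$ does not exist, then $\emptyset\notin\mathcal L(\alpha)$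 for every $\alpha\in r_\omega$; 4. if $\max\Omega$ exists and is not in $r_\omega$, then $\max r_\omega$ exists, $\emptyset\in\mathcal L(\max r_\omega)$, and $\emptyset\notin\mathcal L(\alpha)$ for all other $\alpha\in r_\omega$; 5. if $S\in\mathcal L(\alpha)$, $S'\subseteq A$ and $|S'|=|S|$, then $S'\in\mathcal L(\alpha)$. Put $\mathcal L(\alpha)=\emptyset$ for $\alpha\notin r_\omega$. The *generalized median voter function* associated with $\mathcal L$ is the function $\omega:\Omega^A\to r_\omega$ (required to be well defined) such that $\omega(\mathbf p)=\alpha$ if and only if $\{i\in A:p_i\le^*\alpha\}\in\mathcal L(\alpha)$ and $\{i\in A:p_i\le^*\beta\}\notin\mathcal L(\beta)$ for every $\beta\in r_\omega$ with $\beta<^*\alpha$. A *collection of type-anonymous left-decisive sets* assigns to each $(x,y)\in r_\omega\cap\Omega^2_C$ a collection $W(x,y)$ of subsets of $N$ such that (a) $S\cap D\ne\emptyset$ for each $S\in W(x,y)$; (b) for each inclusion-minimal element $B$ of $\mathcal L(x,y)\setminus\mathcal L(x)$ there is $S\in W(x,y)$ with $S\cap A=B$; (c) no member of $W(x,y)$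 is a proper subset of another; (d) if $S\in W(x,y)$, $S'\subseteq N$, $|S'\cap A|=|S\cap A|$ and $|S'\cap D|=|S\cap D|$, then $S'\in W(x,y)$. *Voting* by $W$ selects, for $(x,y)\in r_\omega\cap\Omega^2_C$, $g_{(x,y)}(R)=x$ if $S\subseteq\{i\in N:x\,P_i\,y\}$ for some $S\in W(x,y)$, and $g_{(x,y)}(R)=y$ otherwise. **Theorem.** The following statements are equivalent: (i) $f$ is strategy-proof and type-anonymous. (ii) $f$ is group strategy-proof and type-anonymous. (iii) There are an admissible set $r_\omega$, a type-anonymous left coalition system $\mathcal L$ on $r_\omega$ with associated generalized median voter function $\omega$, and a collection $W$ of type-anonymous left-decisive sets such that, for each $R\in\mathcal R$ with $p(R)=\mathbf p$, $f(R)=\omega(\mathbf p)$ if $\omega(\mathbf p)\in\Omega$, and $f(R)=g_{\omega(\mathbf p)}(R)$ if $\omega(\mathbf p)\in\Omega^2_C$. Moreover, when these hold, the data in (iii) can be chosen so that $r_\omega$ is exactly the set of values of $\omega$. -/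

import Mathlib

/-! Rules on a domain of single-peaked and single-dipped preferences over a set `X` of reals.
`N` is the set of agents, `A : Set N` the agents with single-peaked preferences, and `Aᶜ` the agents
with single-dipped preferences. -/

/-- A preference over `X`: a complete, transitive and antisymmetric binary relation. -/
structure Preference (X : Set ℝ) where
  weak : X → X → Prop
  complete : ∀ x y, weak x y ∨ weak y x
  trans : ∀ x y z, weak x y → weak y z → weak x z
  antisymm : ∀ x y, weak x y → weak y x → x = y

/-- The strict part `P` of a preference `R`. -/
def Preference.strict {X : Set ℝ} (R : Preference X) (x y : X) : Prop :=
  R.weak x y ∧ ¬ R.weak y x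

def Preference.SinglePeaked {X : Set ℝ} (R : Preference X) : Prop :=
  ∃ ρ : X, ∀ x y : X, (x ≤ ρ ∧ y < x) ∨ (ρ ≤ x ∧ x < y) → R.strict x y

def Preference.SingleDipped {X : Set ℝ} (R : Preference X) : Prop :=
  ∃ δ : X, ∀ x y : X, (x ≤ δ ∧ y < x) ∨ (δ ≤ x ∧ x < y) → R.strict y x

/-- The domain: profiles in which the agents of `A` have single-peaked preferences and all other
agents have single-dipped preferences. -/
def PrefDomain {N : Type*} (X : Set ℝ) (A : Set N) : Type _ :=
  {R : N → Preference X // (∀ i ∈ A, (R i).SinglePeaked) ∧ (∀ i, i ∉ A → (R i).SingleDipped)}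

/-- The preference of agent `i` at a profile. -/
def PrefDomain.pref {N : Type*} {X : Set ℝ} {A : Set N} (R : PrefDomain X A) (i : N) :
    Preference X :=
  R.1 i

/-- The profile in which the preference of agent `i` is that of agent `σ i`, for a permutation `σ`
that respects the types of the agents. -/
def PrefDomain.permute {N : Type*} {X : Set ℝ} {A : Set N} (R : PrefDomain X A)
    (σ : Equiv.Perm N) (hσ : ∀ i, σ i ∈ A ↔ i ∈ A) : PrefDomain X A :=
  ⟨fun i => R.1 (σ i), fun i hi => R.2.1 (σ i) ((hσ i).2 hi),
    fun i hi => R.2.2 (σ i) fun h => hi ((hσ i).1 h)⟩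

/-- Strategy-proofness: no agent `i` gains by a misreport. The profile `R'` is
`(R'_i, R_{-i})`. -/
def StrategyProof {N : Type*} {X : Set ℝ} {A : Set N} (f : PrefDomain X A → X) : Prop :=
  ∀ (R R' : PrefDomain X A) (i : N), (∀ j, j ≠ i → R'.pref j = R.pref j) →
    (R.pref i).weak (f R) (f R')

/-- Group strategy-proofness: no nonempty group `S` has a joint misreport from which all of its
members gain. The profile `R'` is `(R'_S, R_{-S})`. -/
def GroupStrategyProof {N : Type*} {X : Set ℝ} {A : Set N} (f : PrefDomain X A → X) : Prop :=
  ∀ (R R' : PrefDomain X A) (S : Set N), S.Nonempty → (∀ j, j ∉ S → R'.pref j = R.pref j) →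
    ∃ i ∈ S, (R.pref i).weak (f R) (f R')

def TypeAnonymous {N : Type*} {X : Set ℝ} {A : Set N} (f : PrefDomain X A → X) : Prop :=
  ∀ (R : PrefDomain X A) (σ : Equiv.Perm N) (hσ : ∀ i, σ i ∈ A ↔ i ∈ A),
    f R = f (R.permute σ hσ)

/-- `x` is the most preferred alternative in `Ω`. -/
def IsRestrictedPeak {X : Set ℝ} (Ω : Set X) (R : Preference X) (x : X) : Prop :=
  x ∈ Ω ∧ ∀ y ∈ Ω, y ≠ x → R.strict x y

/-- `p` is the vector of `Ω`-restricted peaks of the agents of `A` at the profile `R`. -/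
def IsPeakVector {N : Type*} {X : Set ℝ} {A : Set N} (Ω : Set X) (R : PrefDomain X A)
    (p : A → Ω) : Prop :=
  ∀ i : A, IsRestrictedPeak Ω (R.pref i) (p i)

/-- `(x, y)` is a pair of contiguous alternatives of `Ω`. -/
def Contiguous {X : Set ℝ} (Ω : Set X) (x y : X) : Prop :=
  x ∈ Ω ∧ y ∈ Ω ∧ x < y ∧ ∀ z ∈ Ω, ¬ (x < z ∧ z < y)

/-- Possible results of the first step: a single alternative or an ordered pair. -/
inductive StepValue (X : Set ℝ) where
  | single (x : X) : StepValue X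
  | pair (x y : X) : StepValue X

/-- The set `Ω ∪ Ω²_C` of single alternatives and contiguous pairs of `Ω`. -/
def stepValues {X : Set ℝ} (Ω : Set X) : Set (StepValue X) :=
  {α | (∃ x ∈ Ω, α = .single x) ∨ ∃ x y, Contiguous Ω x y ∧ α = .pair x y}

/-- The order `≤*` on `Ω ∪ Ω²_C`: a contiguous pair lies strictly between its two members. -/
def StepValue.le {X : Set ℝ} : StepValue X → StepValue X → Prop
  | .single x, .single y => x ≤ y
  | .single w, .pair x _ => w ≤ x
  | .pair _ y, .single w => y ≤ w
  | .pair x y, .pair z u => (x = z ∧ y = u) ∨ y ≤ z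

/-- The strict order `<*`. -/
def StepValue.lt {X : Set ℝ} (α β : StepValue X) : Prop :=
  α.le β ∧ α ≠ β

/-- The conditions on the set `r` of values of the first step: it lies in `Ω ∪ Ω²_C`, contains every
alternative of `Ω` other than `min Ω` and `max Ω`, contains `min Ω` (if that exists) or the contiguous
pair with left member `min Ω`, and contains `max Ω` (if that exists) or the contiguous pair with
right member `max Ω`. -/
structure IsStepRange {X : Set ℝ} (Ω : Set X) (r : Set (StepValue X)) : Prop where
  min_mem : ∀ m, IsLeast Ω m →
    (∀ y, Contiguous Ω m y → StepValue.pair m y ∉ r) → StepValue.single m ∈ r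
  max_mem : ∀ m, IsGreatest Ω m →
    (∀ x, Contiguous Ω x m → StepValue.pair x m ∉ r) → StepValue.single m ∈ r
  interior_mem : ∀ x ∈ Ω, ¬ IsLeast Ω x → ¬ IsGreatest Ω x → StepValue.single x ∈ r
  subset : r ⊆ stepValues Ω

/-- Type-anonymous left coalition systems on `r`. The correspondence is a total function with the
value `∅` (no winning coalition) outside `r`. -/
structure IsLeftCoalitionSystem {N : Type*} {X : Set ℝ} (A : Set N) (Ω : Set X)
    (r : Set (StepValue X)) (L : StepValue X → Set (Set N)) : Prop where
  eq_empty : ∀ α, α ∉ r → L α = ∅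
  subset : ∀ α ∈ r, ∀ S ∈ L α, S ⊆ A
  mono : ∀ α ∈ r, ∀ S S' : Set N, S ∈ L α → S ⊆ S' → S' ⊆ A → S' ∈ L α
  nested : ∀ α ∈ r, ∀ β ∈ r, α.lt β → ∀ S ∈ L α, S ∈ L β
  empty_of_no_max : (¬ ∃ m, IsGreatest Ω m) → ∀ α ∈ r, ∅ ∉ L α
  empty_of_max : ∀ m, IsGreatest Ω m → StepValue.single m ∉ r →
    ∃ μ ∈ r, (∀ α ∈ r, α.le μ) ∧ ∅ ∈ L μ ∧ ∀ α ∈ r, α ≠ μ → ∅ ∉ L α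
  anonymous : ∀ α ∈ r, ∀ S S' : Set N, S ∈ L α → S' ⊆ A → S'.ncard = S.ncard → S' ∈ L α

/-- The set of agents of `A` whose peak is to the left of or at `α`. -/
def peaksUpTo {N : Type*} {X : Set ℝ} {A : Set N} {Ω : Set X} (p : A → Ω) (α : StepValue X) :
    Set N :=
  {i | ∃ hi : i ∈ A, (StepValue.single (p ⟨i, hi⟩ : X)).le α}

/-- `ω` is the generalized median voter function on `r` associated with `L`. -/
def IsGeneralizedMedian {N : Type*} {X : Set ℝ} {A : Set N} {Ω : Set X} (r : Set (StepValue X))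
    (L : StepValue X → Set (Set N)) (ω : (A → Ω) → StepValue X) : Prop :=
  ∀ p : A → Ω, ω p ∈ r ∧ ∀ α ∈ r, ω p = α ↔
    (peaksUpTo p α ∈ L α ∧ ∀ β ∈ r, β.lt α → peaksUpTo p β ∉ L β)

/-- Collections of type-anonymous left-decisive sets; `W x y` matters only for pairs in `r`. -/
structure IsLeftDecisive {N : Type*} {X : Set ℝ} (A : Set N) (r : Set (StepValue X))
    (L : StepValue X → Set (Set N)) (W : X → X → Set (Set N)) : Prop where
  inter_dipped : ∀ x y, StepValue.pair x y ∈ r → ∀ S ∈ W x y, (S ∩ Aᶜ).Nonempty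
  inter_peaked : ∀ x y, StepValue.pair x y ∈ r →
    ∀ B, Minimal (fun C => C ∈ L (.pair x y) \ L (.single x)) B → ∃ S ∈ W x y, S ∩ A = B
  minimal : ∀ x y, StepValue.pair x y ∈ r → ∀ S ∈ W x y, ∀ S' ∈ W x y, ¬ S' ⊂ S
  anonymous : ∀ x y, StepValue.pair x y ∈ r → ∀ S ∈ W x y, ∀ S' : Set N,
    (S' ∩ A).ncard = (S ∩ A).ncard → (S' ∩ Aᶜ).ncard = (S ∩ Aᶜ).ncard → S' ∈ W x y

open Classical in
/-- Voting by left-decisive sets between `x` and `y`: `x` is chosen if the set of agents who prefer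
`x` to `y` contains a coalition of `W x y`, otherwise `y` is chosen. -/
noncomputable def voting {N : Type*} {X : Set ℝ} {A : Set N} (W : X → X → Set (Set N)) (x y : X)
    (R : PrefDomain X A) : X :=
  if ∃ S ∈ W x y, S ⊆ {i | (R.pref i).strict x y} then x else y

/-- The final outcome at `R`, given the result of the first step. -/
noncomputable def finalOutcome {N : Type*} {X : Set ℝ} {A : Set N} (W : X → X → Set (Set N))
    (R : PrefDomain X A) : StepValue X → X
  | .single x => x
  | .pair x y => voting W x y R

/-- `f` is the two-step rule given by the set `r`, the type-anonymous left coalition system `L` on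
`r` with generalized median voter function `ω`, and voting by the collection `W` of type-anonymous
left-decisive sets. The set `Ω` is the range of `f`. -/
structure IsTwoStepRule {N : Type*} {X : Set ℝ} {A : Set N} (f : PrefDomain X A → X)
    (r : Set (StepValue X)) (L : StepValue X → Set (Set N))
    (ω : (A → Set.range f) → StepValue X) (W : X → X → Set (Set N)) : Prop where
  range : IsStepRange (Set.range f) r
  system : IsLeftCoalitionSystem A (Set.range f) r L
  median : IsGeneralizedMedian r L ω
  decisive : IsLeftDecisive A r L W
  outcome : ∀ (R : PrefDomain X A) (p : A → Set.range f), IsPeakVector (Set.range f) R p →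
    f R = finalOutcome W R (ω p)

/-! The engine is `StrategyProof.eq_of_weak`: if every agent whose preference changes weakly
prefers, at the old preference, the new outcome, then the outcome has not changed. Monotonicity lets
single-peaked agents who change be given preferences with the new outcome `y` on top, and the sets
of alternatives worse than `y` at single-dipped preferences ranking `y` above the old outcome are
nested. Agents can then be switched one by one in an order that never reaches `y`. Group
strategy-proofness follows, and most later arguments apply this lemma to hybrid profiles.

It gives the structure of a strategy-proof rule. Fixed preferences of `A` leave at most two outcomes
(`not_three_outcomes`); an interior outcome that is the common peak of `A` is chosen
(`eq_of_peaks`); outcomes compatible with the same preferences of `A` have no outcome between them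
(`not_between`); and `A` matters only through its restricted peaks (`eq_of_peak_eq`), monotonically
at each threshold (`le_of_peaks_le`). Hence the outcomes compatible with a peak vector `p` form one
alternative or one contiguous pair, and this is `ω p`. Whether `ω p ≤* α` depends monotonically on
the set of agents with peaks up to `α` (`le_of_subset`), which is what it means to be a generalized
median; the winning coalitions at `α` are those that force `ω ≤* α`. At a pair, the choice is
monotone in the set of supporters of the left member (`eq_left_iff`), and the minimal sufficient
sets of supporters are the left-decisive sets. Anonymity carries over because sets with equally many
agents of each type differ by a type-preserving permutation.

Conversely, a single-peaked agent can move the median only away from the own peak, and the binary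
vote is monotone. -/

/-! ### Preferences and the construction of special single-peaked and single-dipped ones. -/

namespace Preference

variable {X : Set ℝ} (R : Preference X)

theorem weak_refl (x : X) : R.weak x x := (R.complete x x).elim id id

variable {R}

theorem not_weak {x y : X} : ¬ R.weak x y ↔ R.strict y x :=
  ⟨fun h => ⟨(R.complete x y).resolve_left h, h⟩, fun h => h.2⟩

theorem not_strict {x y : X} : ¬ R.strict x y ↔ R.weak y x := by
  rw [← not_weak, not_not]

theorem strict.asymm {x y : X} (h : R.strict x y) : ¬ R.strict y x := fun h' => h.2 h'.1

theorem strict_irrefl (x : X) : ¬ R.strict x x := fun h => h.2 h.1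

theorem strict.ne {x y : X} (h : R.strict x y) : x ≠ y := by
  rintro rfl
  exact strict_irrefl _ h

theorem strict.trans {x y z : X} (h : R.strict x y) (h' : R.strict y z) : R.strict x z :=
  ⟨R.trans _ _ _ h.1 h'.1, fun hz => h.2 (R.trans _ _ _ h'.1 hz)⟩

theorem strict.trans_weak {x y z : X} (h : R.strict x y) (h' : R.weak y z) : R.strict x z :=
  ⟨R.trans _ _ _ h.1 h', fun hz => h.2 (R.trans _ _ _ h' hz)⟩

theorem weak.trans_strict {x y z : X} (h : R.weak x y) (h' : R.strict y z) : R.strict x z :=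
  ⟨R.trans _ _ _ h h'.1, fun hz => h'.2 (R.trans _ _ _ hz h)⟩

theorem strict_of_weak_of_ne {x y : X} (h : R.weak x y) (hne : x ≠ y) : R.strict x y :=
  ⟨h, fun h' => hne (R.antisymm _ _ h h')⟩

theorem strict_or_strict {x y : X} (hne : x ≠ y) : R.strict x y ∨ R.strict y x :=
  (R.complete x y).imp (fun h => strict_of_weak_of_ne h hne)
    fun h => strict_of_weak_of_ne h hne.symm

/-- The reversed preference. -/
def reverse (R : Preference X) : Preference X where
  weak x y := R.weak y x
  complete x y := R.complete y x
  trans _ _ _ h h' := R.trans _ _ _ h' h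
  antisymm _ _ h h' := R.antisymm _ _ h' h

/-- `R` is single-peaked with peak `z`. -/
def PeakedAt (R : Preference X) (z : X) : Prop :=
  ∀ x y : X, (x ≤ z ∧ y < x) ∨ (z ≤ x ∧ x < y) → R.strict x y

/-- `R` is single-dipped with dip `z`. -/
def DippedAt (R : Preference X) (z : X) : Prop :=
  ∀ x y : X, (x ≤ z ∧ y < x) ∨ (z ≤ x ∧ x < y) → R.strict y x

theorem PeakedAt.singlePeaked {z : X} (h : R.PeakedAt z) : R.SinglePeaked := ⟨z, h⟩

theorem DippedAt.singleDipped {z : X} (h : R.DippedAt z) : R.SingleDipped := ⟨z, h⟩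

theorem PeakedAt.left {z x y : X} (h : R.PeakedAt z) (hx : x ≤ z) (hy : y < x) : R.strict x y :=
  h x y (.inl ⟨hx, hy⟩)

theorem PeakedAt.right {z x y : X} (h : R.PeakedAt z) (hx : z ≤ x) (hy : x < y) : R.strict x y :=
  h x y (.inr ⟨hx, hy⟩)

theorem PeakedAt.top {z x : X} (h : R.PeakedAt z) (hx : x ≠ z) : R.strict z x :=
  (lt_or_gt_of_ne hx).elim (h.left le_rfl) (h.right le_rfl)

theorem PeakedAt.weak_top {z : X} (h : R.PeakedAt z) (x : X) : R.weak z x := by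
  rcases eq_or_ne x z with rfl | hx
  exacts [R.weak_refl _, (h.top hx).1]

theorem DippedAt.bot {z x : X} (h : R.DippedAt z) (hx : x ≠ z) : R.strict x z :=
  (lt_or_gt_of_ne hx).elim (fun hx => h z x (.inl ⟨le_rfl, hx⟩))
    fun hx => h z x (.inr ⟨le_rfl, hx⟩)

theorem DippedAt.weak_bot {z : X} (h : R.DippedAt z) (x : X) : R.weak x z := by
  rcases eq_or_ne x z with rfl | hx
  exacts [R.weak_refl _, (h.bot hx).1]

theorem SinglePeaked.between (h : R.SinglePeaked) {a b c : X} (hab : a < b) (hbc : b < c) :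
    R.strict b a ∨ R.strict b c := by
  obtain ⟨z, hz⟩ := h
  rcases le_total b z with h | h
  exacts [.inl (hz _ _ (.inl ⟨h, hab⟩)), .inr (hz _ _ (.inr ⟨h, hbc⟩))]

theorem SingleDipped.between (h : R.SingleDipped) {a b c : X} (hab : a < b) (hbc : b < c) :
    R.strict a b ∨ R.strict c b := by
  obtain ⟨z, hz⟩ := h
  rcases le_total b z with h | h
  exacts [.inl (hz _ _ (.inl ⟨h, hab⟩)), .inr (hz _ _ (.inr ⟨h, hbc⟩))]

/-- There are single-peaked preferences with peak `z` at which the alternatives of a given upper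
set on the left of `z` are better, and the other ones on the left of `z` are worse, than everything
on the right of `z`. -/
theorem exists_peakedAt_of_isUpperSet (z : X) (U : Set X) (hU : IsUpperSet U) :
    ∃ P : Preference X, P.PeakedAt z ∧ (∀ w b, w ∈ U → w ≤ z → z < b → P.strict w b) ∧
      ∀ w b, w ∉ U → w < z → z < b → P.strict b w := by
  classical
  -- Smaller keys are better: blocks come first (`U` on the left together with `z`, then the right,
  -- then the rest of the left), and distance to `z` decides inside a block. A block lies on one
  -- side of `z`, so the key is injective.
  let c : X → ℕ := fun w => if z < w then 1 else if w ∈ U ∨ w = z then 0 else 2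
  let k : X → ℕ ×ₗ ℝ := fun w => toLex (c w, |(w : ℝ) - z|)
  have hlt : ∀ v w, k v < k w ↔ c v < c w ∨ c v = c w ∧ |(v : ℝ) - z| < |(w : ℝ) - z| :=
    fun v w => Prod.Lex.toLex_lt_toLex
  have hcr : ∀ w, z < w → c w = 1 := fun w h => if_pos h
  have hcl : ∀ w, w ≤ z → (w ∈ U ∨ w = z) → c w = 0 := fun w h h' => by
    simp only [c, if_neg h.not_gt, if_pos h']
  have hcl' : ∀ w, w ≤ z → ¬ (w ∈ U ∨ w = z) → c w = 2 := fun w h h' => by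
    simp only [c, if_neg h.not_gt, if_neg h']
  have hinj : ∀ v w, k v = k w → v = w := by
    intro v w h
    obtain ⟨h1, h2⟩ := Prod.ext_iff.1 (toLex.injective h)
    simp only at h1 h2
    have key : z < v ↔ z < w := by
      have : ∀ u, z < u ↔ c u = 1 := fun u => by
        refine ⟨hcr u, fun h => ?_⟩
        by_contra hu
        by_cases h' : u ∈ U ∨ u = z
        · rw [hcl u (not_lt.1 hu) h'] at h; omega
        · rw [hcl' u (not_lt.1 hu) h'] at h; omega
      rw [this, this, h1]
    apply Subtype.ext
    rcases lt_or_ge z v with hv | hv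
    · have hw := key.1 hv
      have hv' : (z : ℝ) < v := hv
      have hw' : (z : ℝ) < w := hw
      rw [abs_of_pos (by linarith), abs_of_pos (by linarith)] at h2
      linarith
    · have hw := not_lt.1 fun h => absurd (key.2 h) hv.not_gt
      have hv' : (v : ℝ) ≤ z := hv
      have hw' : (w : ℝ) ≤ z := hw
      rw [abs_of_nonpos (by linarith), abs_of_nonpos (by linarith)] at h2
      linarith
  let P : Preference X := {
    weak := fun v w => k v ≤ k w
    complete := fun v w => le_total _ _
    trans := fun u v w h h' => le_trans h h'
    antisymm := fun v w h h' => hinj _ _ (le_antisymm h h') }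
  have hP : ∀ v w, P.strict v w ↔ k v < k w := fun v w => lt_iff_le_not_ge.symm
  refine ⟨P, ?_, ?_, ?_⟩
  · rintro x y (⟨hx, hy⟩ | ⟨hx, hy⟩) <;> rw [hP, hlt]
    · have hx' : (x : ℝ) ≤ z := hx
      have hy' : (y : ℝ) < x := hy
      rw [abs_of_nonpos (by linarith), abs_of_nonpos (by linarith)]
      by_cases h : y ∈ U ∨ y = z
      · have hyU : y ∈ U := h.resolve_right (hy.trans_le hx).ne
        rw [hcl y (hy.le.trans hx) h, hcl x hx (.inl (hU hy.le hyU))]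
        right
        exact ⟨rfl, by linarith⟩
      · rw [hcl' y (hy.le.trans hx) h]
        by_cases h' : x ∈ U ∨ x = z
        · rw [hcl x hx h']; left; omega
        · rw [hcl' x hx h']; right; exact ⟨rfl, by linarith⟩
    · have hx' : (z : ℝ) ≤ x := hx
      have hy' : (x : ℝ) < y := hy
      rw [abs_of_nonneg (by linarith), abs_of_nonneg (by linarith), hcr y (hx.trans_lt hy)]
      rcases hx.eq_or_lt with h | h
      · rw [hcl x h.ge (.inr h.symm)]; left; omega
      · rw [hcr x h]; right; exact ⟨rfl, by linarith⟩
  · intro w b hw hwz hb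
    rw [hP, hlt, hcl w hwz (.inl hw), hcr b hb]
    left; omega
  · intro w b hw hwz hb
    rw [hP, hlt, hcr b hb, hcl' w hwz.le (by rintro (h | h); exacts [hw h, hwz.ne h])]
    left; omega

theorem exists_peakedAt_left_first (z : X) :
    ∃ P : Preference X, P.PeakedAt z ∧ ∀ w b, w ≤ z → z < b → P.strict w b := by
  obtain ⟨P, h, h', -⟩ := exists_peakedAt_of_isUpperSet z Set.univ isUpperSet_univ
  exact ⟨P, h, fun w b => h' w b trivial⟩

theorem exists_peakedAt_right_first (z : X) :
    ∃ P : Preference X, P.PeakedAt z ∧ ∀ w b, w < z → z ≤ b → P.strict b w := by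
  obtain ⟨P, h, -, h'⟩ := exists_peakedAt_of_isUpperSet z (Set.Ici z) (isUpperSet_Ici z)
  refine ⟨P, h, fun w b hw hb => ?_⟩
  rcases hb.eq_or_lt with rfl | hb
  exacts [h.left le_rfl hw, h' w b hw.not_ge hw hb]

/-- Single-dipped preferences with dip `z` at which the right of `z` is better than the left. -/
theorem exists_dippedAt_right_first (z : X) :
    ∃ P : Preference X, P.DippedAt z ∧ ∀ w b, w ≤ z → z < b → P.strict b w := by
  obtain ⟨P, h, h'⟩ := exists_peakedAt_left_first z
  exact ⟨P.reverse, h, h'⟩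

theorem exists_dippedAt_left_first (z : X) :
    ∃ P : Preference X, P.DippedAt z ∧ ∀ w b, w < z → z ≤ b → P.strict w b := by
  obtain ⟨P, h, h'⟩ := exists_peakedAt_right_first z
  exact ⟨P.reverse, h, h'⟩

end Preference

/-! ### Hybrid profiles. -/

namespace PrefDomain

variable {N : Type*} {X : Set ℝ} {A : Set N}

theorem singlePeaked (R : PrefDomain X A) {i : N} (hi : i ∈ A) : (R.pref i).SinglePeaked :=
  R.2.1 i hi

theorem singleDipped (R : PrefDomain X A) {i : N} (hi : i ∉ A) : (R.pref i).SingleDipped :=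
  R.2.2 i hi

open Classical in
/-- The profile in which the agents of `S` have the preferences of `R'` and all others those of
`R`. -/
noncomputable def mix (S : Set N) (R' R : PrefDomain X A) : PrefDomain X A :=
  ⟨fun i => if i ∈ S then R'.1 i else R.1 i,
    fun i hi => by dsimp only; split_ifs; exacts [R'.2.1 i hi, R.2.1 i hi],
    fun i hi => by dsimp only; split_ifs; exacts [R'.2.2 i hi, R.2.2 i hi]⟩

theorem mix_mem {S : Set N} {R' R : PrefDomain X A} {i : N} (hi : i ∈ S) :
    (mix S R' R).pref i = R'.pref i := if_pos hi

theorem mix_notMem {S : Set N} {R' R : PrefDomain X A} {i : N} (hi : i ∉ S) :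
    (mix S R' R).pref i = R.pref i := if_neg hi

theorem ext' {R R' : PrefDomain X A} (h : ∀ i, R.pref i = R'.pref i) : R = R' :=
  Subtype.ext (funext h)

open Classical in
/-- The profile made of single-peaked preferences `P` and single-dipped preferences `Q`. -/
noncomputable def glue (P Q : N → Preference X) (hP : ∀ i, (P i).SinglePeaked)
    (hQ : ∀ i, (Q i).SingleDipped) : PrefDomain X A :=
  ⟨fun i => if i ∈ A then P i else Q i,
    fun i hi => by simpa only [if_pos hi] using hP i, fun i hi => by simpa only [if_neg hi] using hQ i⟩

theorem glue_mem {P Q : N → Preference X} {hP : ∀ i, (P i).SinglePeaked}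
    {hQ : ∀ i, (Q i).SingleDipped} {i : N} (hi : i ∈ A) :
    (glue P Q hP hQ : PrefDomain X A).pref i = P i := if_pos hi

theorem glue_notMem {P Q : N → Preference X} {hP : ∀ i, (P i).SinglePeaked}
    {hQ : ∀ i, (Q i).SingleDipped} {i : N} (hi : i ∉ A) :
    (glue P Q hP hQ : PrefDomain X A).pref i = Q i := if_neg hi

end PrefDomain

/-! ### Strategy-proofness implies group strategy-proofness. -/

section GroupStrategyProof

open Preference PrefDomain

variable {N : Type*} {X : Set ℝ} {A : Set N} {f : PrefDomain X A → X}

/-- Maskin monotonicity: the outcome does not change if it weakly rises in the preferences of all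
agents. -/
theorem StrategyProof.monotone [Finite N] (hf : StrategyProof f) {R R' : PrefDomain X A}
    (h : ∀ i, R'.pref i = R.pref i ∨
      ∀ w, (R'.pref i).weak w (f R) → (R.pref i).weak w (f R)) : f R' = f R := by
  have key : ∀ S : Set N, S.Finite → f (mix S R' R) = f R := by
    intro S hS
    induction S, hS using Set.Finite.induction_on with
    | empty => exact congrArg f (ext' fun i => mix_notMem (Set.notMem_empty i))
    | @insert a S ha _ ih =>
      have hoff : ∀ j, j ≠ a → (mix (insert a S) R' R).pref j = (mix S R' R).pref j := by
        intro j hj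
        by_cases hjS : j ∈ S
        · rw [mix_mem hjS, mix_mem (Set.mem_insert_of_mem a hjS)]
        · rw [mix_notMem hjS, mix_notMem (by simp [hj, hjS])]
      rcases h a with h | h
      · rw [← ih]
        refine congrArg f (ext' fun i => ?_)
        rcases eq_or_ne i a with rfl | hi
        · rw [mix_mem (Set.mem_insert _ _), mix_notMem ha, h]
        · exact hoff i hi
      · have h1 := hf (mix S R' R) (mix (insert a S) R' R) a hoff
        have h2 := hf (mix (insert a S) R' R) (mix S R' R) a fun j hj => (hoff j hj).symm
        rw [ih, mix_notMem ha] at h1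
        rw [ih, mix_mem (Set.mem_insert _ _)] at h2
        exact (R.pref a).antisymm _ _ (h _ h2) h1
  rw [← key Set.univ Set.finite_univ]
  exact congrArg f (ext' fun i => (mix_mem (Set.mem_univ i)).symm)

/-- Switch first the agent with the smallest set of alternatives worse than `y`. By
strategy-proofness the new outcome stays in that set, hence in the corresponding set of every
remaining agent, and the induction continues. -/
theorem StrategyProof.ne_of_nested (hf : StrategyProof f) (y : X) :
    ∀ (n : ℕ) (S : Finset N), S.card = n → ∀ R R' : PrefDomain X A,
      (∀ j, j ∉ S → R'.pref j = R.pref j) → f R ≠ y → (∀ i ∈ S, (R.pref i).strict y (f R)) →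
      (∀ i ∈ S, ∀ j ∈ S, (∀ w, (R.pref i).strict y w → (R.pref j).strict y w) ∨
        ∀ w, (R.pref j).strict y w → (R.pref i).strict y w) → f R' ≠ y := by
  classical
  intro n
  induction n with
  | zero =>
    intro S hS R R' hoff hne _ _
    have : R' = R := ext' fun i => hoff i (by simp [Finset.card_eq_zero.1 hS])
    rwa [this]
  | succ n ih =>
    intro S hS R R' hoff hne hstrict hchain
    obtain ⟨i, hi, hmin⟩ : ∃ i ∈ S, ∀ j ∈ S,
        ∀ w, (R.pref i).strict y w → (R.pref j).strict y w := by
      have hne' : S.Nonempty := Finset.card_pos.1 (by omega)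
      obtain ⟨i, hi⟩ := S.exists_minimalFor (fun i => {w | (R.pref i).strict y w}) hne'
      refine ⟨i, hi.1, fun j hj => ?_⟩
      rcases hchain i hi.1 j hj with h | h
      · exact h
      · exact hi.2 hj h
    set R₁ := mix {i} R' R with hR₁
    have hoff₁ : ∀ j, j ≠ i → R₁.pref j = R.pref j := fun j hj => mix_notMem hj
    have hv : (R.pref i).strict y (f R₁) := (hstrict i hi).trans_weak (hf R R₁ i hoff₁)
    refine ih (S.erase i) (by rw [Finset.card_erase_of_mem hi]; omega) R₁ R' ?_ hv.ne.symm ?_ ?_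
    · intro j hj
      rcases eq_or_ne j i with rfl | hji
      · exact (mix_mem rfl).symm
      · rw [hoff₁ j hji]
        exact hoff j fun h => hj (Finset.mem_erase.2 ⟨hji, h⟩)
    · intro j hj
      rw [hoff₁ j (Finset.ne_of_mem_erase hj)]
      exact hmin j (Finset.mem_of_mem_erase hj) _ hv
    · intro j hj k hk
      rw [hoff₁ j (Finset.ne_of_mem_erase hj), hoff₁ k (Finset.ne_of_mem_erase hk)]
      exact hchain j (Finset.mem_of_mem_erase hj) k (Finset.mem_of_mem_erase hk)

/-- At a single-dipped preference, the alternatives worse than `y` lie on one side of `y` and fill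
everything from `y` up to the farthest of them. Both sets contain `z`, so they lie on the same side
and one contains the other. -/
theorem Preference.SingleDipped.nested {R R' : Preference X} (h : R.SingleDipped)
    (h' : R'.SingleDipped) {y z : X} (hz : R.strict y z) (hz' : R'.strict y z) :
    (∀ w, R.strict y w → R'.strict y w) ∨ ∀ w, R'.strict y w → R.strict y w := by
  have side : ∀ {Q : Preference X}, Q.SingleDipped → Q.strict y z → ∀ w, Q.strict y w →
      (y < z ∧ y < w) ∨ (z < y ∧ w < y) := by
    intro Q hQ hz w hw
    rcases lt_or_gt_of_ne hz.ne with h1 | h1 <;> rcases lt_or_gt_of_ne hw.ne with h2 | h2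
    · exact .inl ⟨h1, h2⟩
    · rcases hQ.between h2 h1 with h | h
      exacts [(h.asymm hw).elim, (h.asymm hz).elim]
    · rcases hQ.between h1 h2 with h | h
      exacts [(h.asymm hz).elim, (h.asymm hw).elim]
    · exact .inr ⟨h1, h2⟩
  have conv : ∀ {Q : Preference X}, Q.SingleDipped → ∀ v w, Q.strict y w →
      (y < v ∧ v ≤ w) ∨ (w ≤ v ∧ v < y) → Q.strict y v := by
    rintro Q hQ v w hw (⟨h1, h2⟩ | ⟨h2, h1⟩)
    · rcases h2.eq_or_lt with rfl | h2
      · exact hw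
      · exact (hQ.between h1 h2).elim id hw.trans
    · rcases h2.eq_or_lt with rfl | h2
      · exact hw
      · exact (hQ.between h2 h1).elim hw.trans id
  by_contra! hcon
  obtain ⟨⟨w, hw1, hw2⟩, v, hv1, hv2⟩ := hcon
  rcases side h hz w hw1 with ⟨h1, h2⟩ | ⟨h1, h2⟩ <;>
    rcases side h' hz' v hv1 with ⟨h3, h4⟩ | ⟨h3, h4⟩
  · rcases le_total v w with h5 | h5
    · exact hv2 (conv h v w hw1 (.inl ⟨h4, h5⟩))
    · exact hw2 (conv h' w v hv1 (.inl ⟨h2, h5⟩))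
  · exact h1.not_gt h3
  · exact h1.not_gt h3
  · rcases le_total v w with h5 | h5
    · exact hw2 (conv h' w v hv1 (.inr ⟨h5, h2⟩))
    · exact hv2 (conv h v w hw1 (.inr ⟨h5, h4⟩))

/-- Made for `StrategyProof.monotone`: a single-peaked agent who prefers `y` to the outcome `z`
finds everything between them at least as good as `z`, so adopting `P` leaves the outcome at `z`. -/
theorem Preference.exists_peakedAt_toward (y z : X) : ∃ P : Preference X, P.PeakedAt y ∧
    ∀ w, P.weak w z → (y ≤ w ∧ w ≤ z) ∨ (z ≤ w ∧ w ≤ y) := by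
  rcases le_total y z with h | h
  · obtain ⟨P, hP, hP'⟩ := exists_peakedAt_right_first y
    refine ⟨P, hP, fun w hw => .inl ⟨?_, ?_⟩⟩ <;> by_contra! hlt
    · exact (hP' w z hlt h).2 hw
    · exact (hP.right h hlt).2 hw
  · obtain ⟨P, hP, hP'⟩ := exists_peakedAt_left_first y
    refine ⟨P, hP, fun w hw => .inr ⟨?_, ?_⟩⟩ <;> by_contra! hlt
    · exact (hP.left h hlt).2 hw
    · exact (hP' z w h hlt).2 hw

/-- At a single-peaked preference, everything between two alternatives is weakly better than the
worse one. -/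
theorem Preference.SinglePeaked.weak_of_between {R : Preference X} (h : R.SinglePeaked)
    {y z w : X} (hyz : R.weak y z) (hw : (y ≤ w ∧ w ≤ z) ∨ (z ≤ w ∧ w ≤ y)) : R.weak w z := by
  rcases eq_or_ne w y with rfl | h1
  · exact hyz
  rcases eq_or_ne w z with rfl | h2
  · exact R.weak_refl _
  rcases hw with ⟨h3, h4⟩ | ⟨h3, h4⟩
  · exact (h.between (lt_of_le_of_ne h3 h1.symm) (lt_of_le_of_ne h4 h2)).elim
      (fun h => R.trans _ _ _ h.1 hyz) fun h => h.1
  · exact (h.between (lt_of_le_of_ne h3 h2.symm) (lt_of_le_of_ne h4 h1)).elim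
      (fun h => h.1) fun h => R.trans _ _ _ h.1 hyz

/-- On this domain strategy-proofness implies group strategy-proofness: a change of preferences
towards an outcome that all agents who change weakly prefer cannot change the outcome. -/
theorem StrategyProof.eq_of_weak [Finite N] (hf : StrategyProof f) {R R' : PrefDomain X A}
    (h : ∀ i, R'.pref i = R.pref i ∨ (R.pref i).weak (f R') (f R)) : f R' = f R := by
  classical
  cases nonempty_fintype N
  by_contra hne
  set y := f R' with hy
  set z := f R with hz
  obtain ⟨P, hP, hPz⟩ := exists_peakedAt_toward y z
  obtain ⟨Q, hQ, -⟩ := exists_dippedAt_left_first y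
  let S : Set N := {i | R'.pref i ≠ R.pref i}
  have hS : ∀ i ∈ S, (R.pref i).strict y z := fun i hi =>
    strict_of_weak_of_ne ((h i).resolve_left hi) hne
  let G : PrefDomain X A := glue (fun _ => P) (fun _ => Q) (fun _ => hP.singlePeaked)
    fun _ => hQ.singleDipped
  -- The deviating single-peaked agents first adopt `P`, at no cost by monotonicity. Then `y` is
  -- their top, so the set of alternatives worse than `y` is maximal for them and the chain
  -- condition has content only among single-dipped agents.
  let R₁ := mix (S ∩ A) G R
  have hR₁A : ∀ i ∈ S, i ∈ A → R₁.pref i = P := fun i hi hiA => by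
    have hmem : i ∈ S ∩ A := ⟨hi, hiA⟩
    rw [mix_mem hmem, glue_mem hiA]
  have hR₁ : ∀ i, ¬ (i ∈ S ∧ i ∈ A) → R₁.pref i = R.pref i := fun i hi => mix_notMem hi
  have hf₁ : f R₁ = z := by
    refine hf.monotone fun i => ?_
    by_cases hi : i ∈ S ∧ i ∈ A
    · right
      intro w hw
      rw [hR₁A i hi.1 hi.2] at hw
      exact (R.singlePeaked hi.2).weak_of_between (hS i hi.1).1 (hPz w hw)
    · exact .inl (hR₁ i hi)
  have htop : ∀ w, w ≠ y → P.strict y w := fun w hw => hP.top hw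
  refine hf.ne_of_nested y _ (Finset.univ.filter (· ∈ S)) rfl R₁ R' ?_ ?_ ?_ ?_ hy.symm
  · intro j hj
    have hj' : j ∉ S := by simpa using hj
    rw [hR₁ j fun h => hj' h.1]
    exact not_not.1 hj'
  · rw [hf₁]; exact Ne.symm hne
  · intro i hi
    have hi' : i ∈ S := by simpa using hi
    rw [hf₁]
    by_cases hiA : i ∈ A
    · rw [hR₁A i hi' hiA]; exact htop z (Ne.symm hne)
    · rw [hR₁ i fun h => hiA h.2]; exact hS i hi'
  · intro i hi j hj
    have hi' : i ∈ S := by simpa using hi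
    have hj' : j ∈ S := by simpa using hj
    by_cases hiA : i ∈ A
    · right
      intro w hw
      rw [hR₁A i hi' hiA]
      exact htop w hw.ne.symm
    · by_cases hjA : j ∈ A
      · left
        intro w hw
        rw [hR₁A j hj' hjA]
        exact htop w hw.ne.symm
      · rw [hR₁ i fun h => hiA h.2, hR₁ j fun h => hjA h.2]
        exact (R.singleDipped hiA).nested (R.singleDipped hjA) (hS i hi') (hS j hj')

theorem StrategyProof.groupStrategyProof [Finite N] (hf : StrategyProof f) :
    GroupStrategyProof f := by
  intro R R' S hS hoff
  by_contra! hcon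
  have : f R' = f R := hf.eq_of_weak fun i => by
    by_cases hi : i ∈ S
    · exact .inr (not_weak.1 (hcon i hi)).1
    · exact .inl (hoff i hi)
  obtain ⟨i, hi⟩ := hS
  exact hcon i hi (this ▸ (R.pref i).weak_refl _)

theorem GroupStrategyProof.strategyProof (hf : GroupStrategyProof f) : StrategyProof f := by
  intro R R' i hoff
  obtain ⟨j, rfl, hj⟩ := hf R R' {i} (Set.singleton_nonempty i) fun j hj => hoff j hj
  exact hj

end GroupStrategyProof

/-! ### At most two outcomes for given preferences of `A`, and unanimity at interior outcomes. -/

section Outcomes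

open Preference PrefDomain

variable {N : Type*} [Finite N] {X : Set ℝ} {A : Set N} {f : PrefDomain X A → X}

/-- If `b` and `c` are outcomes for the same preferences of the agents of `A`, then at a profile at
which `b` is the worst alternative for the other agents the outcome is not on the side `lo` of `b`
opposite to `c`. -/
theorem StrategyProof.not_lo (hf : StrategyProof f) {b : X} {lo hi : X → Prop}
    (hcover : ∀ w, lo w ∨ w = b ∨ hi w) (hlob : ¬ lo b) (hhib : ¬ hi b)
    {Rb Rc T : PrefDomain X A} (hRc : ∀ i ∈ A, Rc.pref i = Rb.pref i)
    (hT : ∀ i ∈ A, T.pref i = Rb.pref i) (hfb : f Rb = b) (hfc : hi (f Rc)) (Dl : Set N)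
    (hl : ∀ i ∉ A, i ∈ Dl → ∀ w, lo w → (Rb.pref i).strict w b)
    (hr : ∀ i ∉ A, i ∉ Dl → ∀ w, hi w → (Rb.pref i).strict w b)
    (hTb : ∀ i ∉ A, ∀ w, (T.pref i).weak w b)
    (hTr : ∀ i ∉ A, i ∉ Dl → ∀ w v, lo w → hi v → (T.pref i).strict v w) : ¬ lo (f T) := by
  intro hlo
  -- The outcome at `V` is not in `lo`, or the agents of `Dl` would gain by leaving `Rb`; nor in
  -- `hi`, or the others would gain by leaving `T`. So it is `b`, and then all single-dipped agents
  -- weakly gain by moving on to `Rc`.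
  let V := mix Dl T Rb
  have hVl : ∀ i ∈ Dl, V.pref i = T.pref i := fun i hi => mix_mem hi
  have hVr : ∀ i, i ∉ Dl → V.pref i = Rb.pref i := fun i hi => mix_notMem hi
  have hVA : ∀ i ∈ A, V.pref i = Rb.pref i := fun i hiA => by
    by_cases hi : i ∈ Dl
    exacts [(hVl i hi).trans (hT i hiA), hVr i hi]
  have h1 : ¬ lo (f V) := by
    intro h
    have : f V = f Rb := hf.eq_of_weak fun i => by
      by_cases hiA : i ∈ A
      · exact .inl (hVA i hiA)
      by_cases hi : i ∈ Dl
      · right; rw [hfb]; exact (hl i hiA hi _ h).1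
      · exact .inl (hVr i hi)
    exact hlob (by rwa [this, hfb] at h)
  have h2 : ¬ hi (f V) := by
    intro h
    have : f V = f T := hf.eq_of_weak fun i => by
      by_cases hiA : i ∈ A
      · exact .inl ((hVA i hiA).trans (hT i hiA).symm)
      by_cases hi : i ∈ Dl
      · exact .inl (hVl i hi)
      · exact .inr (hTr i hiA hi _ _ hlo h).1
    exact h1 (this ▸ hlo)
  have hv : f V = b := ((hcover (f V)).resolve_left h1).resolve_right h2
  have : f Rc = f V := hf.eq_of_weak fun i => by
    by_cases hiA : i ∈ A
    · exact .inl ((hRc i hiA).trans (hVA i hiA).symm)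
    right
    rw [hv]
    by_cases hi : i ∈ Dl
    · rw [hVl i hi]; exact hTb i hiA _
    · rw [hVr i hi]; exact (hr i hiA hi _ hfc).1
  rw [this, hv] at hfc
  exact hhib hfc

/-- A single-dipped preference ranks above `b` everything on its left or everything on its right. At
`T` all dips are moved to the middle outcome `b`, each agent ranking first a side that was already
above `b`. The outcome `b` itself is impossible, being worst for all agents free to move to `Ra`;
`not_lo` and its mirror image exclude the two sides. -/
theorem StrategyProof.not_three_outcomes_of_lt (hf : StrategyProof f) {Ra Rb Rc : PrefDomain X A}
    (ha : ∀ i ∈ A, Ra.pref i = Rb.pref i) (hc : ∀ i ∈ A, Rc.pref i = Rb.pref i)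
    (hab : f Ra < f Rb) (hbc : f Rb < f Rc) : False := by
  set b := f Rb with hb
  obtain ⟨P, hP, -⟩ := exists_peakedAt_left_first b
  obtain ⟨TL, hTL, hTL'⟩ := exists_dippedAt_left_first b
  obtain ⟨TR, hTR, hTR'⟩ := exists_dippedAt_right_first b
  let Dl : Set N := {i | ∀ w, w < b → (Rb.pref i).strict w b}
  let Gl : PrefDomain X A := glue (fun _ => P) (fun _ => TL) (fun _ => hP.singlePeaked)
    fun _ => hTL.singleDipped
  let Gr : PrefDomain X A := glue (fun _ => P) (fun _ => TR) (fun _ => hP.singlePeaked)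
    fun _ => hTR.singleDipped
  let T := mix A Rb (mix Dl Gl Gr)
  have hT : ∀ i ∈ A, T.pref i = Rb.pref i := fun i hi => mix_mem hi
  have hTl : ∀ i ∉ A, i ∈ Dl → T.pref i = TL := fun i hiA hi => by
    rw [mix_notMem hiA, mix_mem hi, glue_notMem hiA]
  have hTr : ∀ i ∉ A, i ∉ Dl → T.pref i = TR := fun i hiA hi => by
    rw [mix_notMem hiA, mix_notMem hi, glue_notMem hiA]
  have hr : ∀ i ∉ A, i ∉ Dl → ∀ w, b < w → (Rb.pref i).strict w b := by
    intro i hiA hi w hw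
    have hi' : ¬ ∀ w, w < b → (Rb.pref i).strict w b := hi
    push Not at hi'
    obtain ⟨v, hv, hv'⟩ := hi'
    exact ((Rb.singleDipped hiA).between hv hw).resolve_left hv'
  have hTb : ∀ i ∉ A, ∀ w, (T.pref i).weak w b := by
    intro i hiA w
    by_cases hi : i ∈ Dl
    · rw [hTl i hiA hi]; exact hTL.weak_bot w
    · rw [hTr i hiA hi]; exact hTR.weak_bot w
  rcases lt_trichotomy (f T) b with h | h | h
  · refine hf.not_lo (b := b) (lo := (· < b)) (hi := (b < ·)) (fun w => lt_trichotomy w b)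
      (lt_irrefl b) (lt_irrefl b) hc hT rfl hbc Dl (fun i _ hi w hw => hi w hw) hr hTb ?_ h
    intro i hiA hi w v hw hv
    rw [hTr i hiA hi]
    exact hTR' w v (le_of_lt hw) hv
  · have : f Ra = f T := hf.eq_of_weak fun i => by
      by_cases hiA : i ∈ A
      · exact .inl ((ha i hiA).trans (hT i hiA).symm)
      · right; rw [h]; exact hTb i hiA _
    exact hab.ne (this.trans h)
  · refine hf.not_lo (b := b) (lo := (b < ·)) (hi := (· < b))
      (fun w => by rcases lt_trichotomy w b with h | h | h <;> simp [h])
      (lt_irrefl b) (lt_irrefl b) ha hT rfl hab Dlᶜ (fun i hiA hi => hr i hiA hi)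
      (fun i _ hi w hw => not_not.1 hi w hw) hTb ?_ h
    intro i hiA hi w v hw hv
    rw [hTl i hiA (not_not.1 hi)]
    exact hTL' v w hv (le_of_lt hw)

/-- For given preferences of the agents of `A` there are at most two outcomes. -/
theorem StrategyProof.not_three_outcomes (hf : StrategyProof f) {R₁ R₂ R₃ : PrefDomain X A}
    (h₁ : ∀ i ∈ A, R₁.pref i = R₂.pref i) (h₃ : ∀ i ∈ A, R₃.pref i = R₂.pref i)
    (h₁₂ : f R₁ ≠ f R₂) : f R₃ = f R₁ ∨ f R₃ = f R₂ := by
  by_contra! hcon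
  obtain ⟨hc1, hc2⟩ := hcon
  have h₂₁ : ∀ i ∈ A, R₂.pref i = R₁.pref i := fun i hi => (h₁ i hi).symm
  have h₂₃ : ∀ i ∈ A, R₂.pref i = R₃.pref i := fun i hi => (h₃ i hi).symm
  have h₁₃ : ∀ i ∈ A, R₁.pref i = R₃.pref i := fun i hi => (h₁ i hi).trans (h₂₃ i hi)
  have h₃₁ : ∀ i ∈ A, R₃.pref i = R₁.pref i := fun i hi => (h₁₃ i hi).symm
  rcases lt_or_gt_of_ne h₁₂ with a | a <;> rcases lt_or_gt_of_ne hc1 with b | b <;>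
    rcases lt_or_gt_of_ne hc2 with c | c
  · exact hf.not_three_outcomes_of_lt h₃₁ h₂₁ b a
  · exact absurd (c.trans b) a.not_gt
  · exact hf.not_three_outcomes_of_lt h₁₃ h₂₃ b c
  · exact hf.not_three_outcomes_of_lt h₁ h₃ a c
  · exact hf.not_three_outcomes_of_lt h₃ h₁ c a
  · exact hf.not_three_outcomes_of_lt h₂₃ h₁₃ c b
  · exact absurd (c.trans a) b.not_gt
  · exact hf.not_three_outcomes_of_lt h₂₁ h₃₁ a b

/-- If the outcome were in `lo`, the outcomes available with `A` as in `R` would be `z` and `f R`,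
and those with `A` as in `G` would be `z` and `f G`, the latter in `hi`. Suitable preferences `E` of
the other agents select `z` in the first case and `f G` in the second. But agents of `A` with peak
`z` could then pass from the second profile to the first. The predicates `lo` and `hi` serve both
orientations. -/
theorem StrategyProof.not_lo_of_peaks (hf : StrategyProof f) {z : X} {lo hi : X → Prop}
    (hcover : ∀ w, lo w ∨ w = z ∨ hi w) (hloz : ¬ lo z) (hdisj : ∀ w, lo w → ¬ hi w)
    (hdip : ∀ (Q : Preference X), Q.SingleDipped → ∀ w v, lo w → hi v →
      Q.strict w z ∨ Q.strict v z)
    {P T : Preference X} (hP : P.PeakedAt z) (hT : T.DippedAt z)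
    (hP' : ∀ w v, lo w → hi v → P.strict v w) (hT' : ∀ w v, lo w → hi v → T.strict v w)
    {R Rz Rc : PrefDomain X A} (hR : ∀ i ∈ A, IsRestrictedPeak (Set.range f) (R.pref i) z)
    (hfz : f Rz = z) (hfc : hi (f Rc)) : ¬ lo (f R) := by
  intro hlo
  have hxz : f R ≠ z := fun h => hloz (h ▸ hlo)
  have htop : ∀ i ∈ A, ∀ R', (R.pref i).weak z (f R') := by
    intro i hi R'
    rcases eq_or_ne (f R') z with h | h
    · rw [h]; exact Preference.weak_refl _ _
    · exact ((hR i hi).2 _ ⟨R', rfl⟩ h).1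
  let G : PrefDomain X A := glue (fun _ => P) (fun _ => T) (fun _ => hP.singlePeaked)
    fun _ => hT.singleDipped
  have hGA : ∀ i ∈ A, G.pref i = P := fun i hi => glue_mem hi
  have hGD : ∀ i ∉ A, G.pref i = T := fun i hi => glue_notMem hi
  let M : PrefDomain X A := mix A R Rz
  have hM : f M = z := by
    rw [← hfz]
    refine (hf.eq_of_weak fun i => ?_).symm
    by_cases hi : i ∈ A
    · right; rw [mix_mem hi, hfz]; exact htop i hi _
    · exact .inl (mix_notMem hi).symm
  let M' : PrefDomain X A := mix A G Rz
  have hM' : f M' = z := by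
    rw [← hfz]
    refine (hf.eq_of_weak fun i => ?_).symm
    by_cases hi : i ∈ A
    · right; rw [mix_mem hi, hfz, hGA i hi]; exact hP.weak_top _
    · exact .inl (mix_notMem hi).symm
  let R₁ : PrefDomain X A := mix A R G
  have hfR₁ : f R₁ = f R := by
    refine (hf.not_three_outcomes (R₁ := R) (R₂ := M) (R₃ := R₁) (fun i hi => (mix_mem hi).symm)
      (fun i hi => (mix_mem hi).trans (mix_mem hi).symm) (by rwa [hM])).resolve_right fun h => ?_
    refine hxz ((hf.eq_of_weak fun i => ?_ : f R = f R₁).trans (h.trans hM))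
    by_cases hi : i ∈ A
    · exact .inl (mix_mem hi).symm
    · right; rw [mix_notMem hi, h, hM, hGD i hi]; exact hT.weak_bot _
  have hu : hi (f G) := by
    refine ((hcover (f G)).resolve_left fun h => ?_).resolve_left fun h => ?_
    · have : f Rc = f G := hf.eq_of_weak fun i => by
        by_cases hi : i ∈ A
        · right; rw [hGA i hi]; exact (hP' _ _ h hfc).1
        · right; rw [hGD i hi]; exact (hT' _ _ h hfc).1
      exact hdisj _ h (this ▸ hfc)
    · have : f G = f R₁ := hf.eq_of_weak fun i => by
        by_cases hi : i ∈ A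
        · right; rw [mix_mem hi, h]; exact htop i hi _
        · exact .inl (mix_notMem hi).symm
      exact hxz (hfR₁.symm.trans (this.symm.trans h))
  have huz : f G ≠ z := fun h => by
    rw [h] at hu
    exact absurd hu (by
      intro hz
      rcases hdip T hT.singleDipped _ _ hlo hz with h' | h'
      · exact (strict_irrefl z) (hT' _ _ hlo hz |>.trans h')
      · exact strict_irrefl z h')
  -- Single-dipped agents in `B` like `f R` better than `z` at `Rz`, so their switch cannot lead
  -- from `z` to `f R`. Those outside `B` like `f G` better than `z`, so their switch cannot lead
  -- from `z` to `f G`.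
  let B : Set N := {i | (Rz.pref i).strict (f R) z}
  let E : PrefDomain X A := mix B G Rz
  let E₁ : PrefDomain X A := mix A R E
  let E₂ : PrefDomain X A := mix A G E
  have hE₁ : f E₁ = z := by
    rw [← hM]
    refine (hf.not_three_outcomes (R₁ := R) (R₂ := M) (R₃ := E₁) (fun i hi => (mix_mem hi).symm)
      (fun i hi => (mix_mem hi).trans (mix_mem hi).symm) (by rwa [hM])).resolve_left fun h => ?_
    refine hxz (h.symm.trans ((hf.eq_of_weak fun i => ?_ : f E₁ = f M).trans hM))
    by_cases hi : i ∈ A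
    · exact .inl ((mix_mem hi).trans (mix_mem hi).symm)
    by_cases hB : i ∈ B
    · right; rw [mix_notMem hi, h, hM]; exact hB.1
    · left; rw [mix_notMem hi, mix_notMem hi, mix_notMem hB]
  have hE₂ : f E₂ = f G := by
    refine (hf.not_three_outcomes (R₁ := G) (R₂ := M') (R₃ := E₂) (fun i hi => (mix_mem hi).symm)
      (fun i hi => (mix_mem hi).trans (mix_mem hi).symm) (by rwa [hM'])).resolve_right fun h => ?_
    refine huz ((hf.eq_of_weak fun i => ?_ : f G = f E₂).trans (h.trans hM'))
    by_cases hi : i ∈ A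
    · exact .inl (mix_mem hi).symm
    by_cases hB : i ∈ B
    · left; rw [mix_notMem hi, mix_mem hB]
    · right
      rw [mix_notMem hi, mix_notMem hB, h, hM']
      exact ((hdip _ (Rz.singleDipped hi) _ _ hlo hu).resolve_left hB).1
  refine huz (hE₂.symm.trans ((hf.eq_of_weak fun i => ?_ : f E₁ = f E₂).symm.trans hE₁))
  by_cases hi : i ∈ A
  · right; rw [mix_mem hi, hE₁, hGA i hi]; exact hP.weak_top _
  · left; rw [mix_notMem hi, mix_notMem hi]

/-- If an alternative that is neither the least nor the greatest outcome is the restricted peak of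
all agents of `A`, then it is the outcome. -/
theorem StrategyProof.eq_of_peaks (hf : StrategyProof f) {z : X} {R Ra Rz Rc : PrefDomain X A}
    (hR : ∀ i ∈ A, IsRestrictedPeak (Set.range f) (R.pref i) z)
    (ha : f Ra < z) (hz : f Rz = z) (hc : z < f Rc) : f R = z := by
  rcases lt_trichotomy (f R) z with h | h | h
  · obtain ⟨P, hP, hP'⟩ := exists_peakedAt_right_first z
    obtain ⟨T, hT, hT'⟩ := exists_dippedAt_right_first z
    exact (hf.not_lo_of_peaks (lo := (· < z)) (hi := (z < ·)) (fun w => lt_trichotomy w z)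
      (lt_irrefl z) (fun w hw => hw.not_gt) (fun Q hQ w v hw hv => hQ.between hw hv) hP hT
      (fun w v hw hv => hP' w v hw (le_of_lt hv)) (fun w v hw hv => hT' w v (le_of_lt hw) hv)
      hR hz hc h).elim
  · exact h
  · obtain ⟨P, hP, hP'⟩ := exists_peakedAt_left_first z
    obtain ⟨T, hT, hT'⟩ := exists_dippedAt_left_first z
    exact (hf.not_lo_of_peaks (lo := (z < ·)) (hi := (· < z))
      (fun w => by rcases lt_trichotomy w z with h | h | h <;> simp [h])
      (lt_irrefl z) (fun w hw => hw.not_gt) (fun Q hQ w v hw hv => (hQ.between hv hw).symm) hP hT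
      (fun w v hw hv => hP' v w (le_of_lt hv) hw) (fun w v hw hv => hT' v w hv (le_of_lt hw))
      hR hz ha h).elim

end Outcomes

/-! ### Dependence on the restricted peaks of `A` only, contiguity, and monotonicity in the peaks.
-/

section Peaks

open Preference PrefDomain

variable {X : Set ℝ} {Ω : Set X}

theorem IsRestrictedPeak.weak {R : Preference X} {p : X} (h : IsRestrictedPeak Ω R p) {y : X}
    (hy : y ∈ Ω) : R.weak p y := by
  rcases eq_or_ne y p with rfl | hne
  exacts [R.weak_refl _, (h.2 y hy hne).1]

theorem IsRestrictedPeak.unique {R : Preference X} {p q : X} (h : IsRestrictedPeak Ω R p)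
    (h' : IsRestrictedPeak Ω R q) : p = q :=
  R.antisymm _ _ (h.weak h'.1) (h'.weak h.1)

theorem IsRestrictedPeak.right {R : Preference X} {p : X} (h : IsRestrictedPeak Ω R p)
    (hR : R.SinglePeaked) {x y : X} (hy : y ∈ Ω) (hpx : p ≤ x) (hxy : x < y) : R.strict x y := by
  rcases hpx.eq_or_lt with rfl | hpx
  · exact h.2 y hy hxy.ne'
  · exact (hR.between hpx hxy).elim (fun h' => h'.trans_weak (h.weak hy)) id

theorem IsRestrictedPeak.left {R : Preference X} {p : X} (h : IsRestrictedPeak Ω R p)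
    (hR : R.SinglePeaked) {x y : X} (hy : y ∈ Ω) (hxp : x ≤ p) (hyx : y < x) : R.strict x y := by
  rcases hxp.eq_or_lt with rfl | hxp
  · exact h.2 y hy hyx.ne
  · exact (hR.between hyx hxp).elim id (fun h' => h'.trans_weak (h.weak hy))

theorem Preference.PeakedAt.isRestrictedPeak {R : Preference X} {p : X} (h : R.PeakedAt p)
    (hp : p ∈ Ω) : IsRestrictedPeak Ω R p := ⟨hp, fun _ _ hne => h.top hne⟩

/-- Single-peaked preferences with peak `z` at which the alternatives between `x` and `z` come
first, followed by those on the right of `z`. -/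
theorem Preference.exists_peakedAt_cut {x z : X} (hxz : x < z) :
    ∃ P : Preference X, P.PeakedAt z ∧ (∀ v, v < x ∨ z < v → P.strict x v) ∧
      ∀ y, z < y → ∀ w, P.weak w y → x ≤ w ∧ w ≤ y := by
  obtain ⟨P, hP, hP', hP''⟩ := exists_peakedAt_of_isUpperSet z (Set.Ici x) (isUpperSet_Ici x)
  refine ⟨P, hP, ?_, fun y hy w hw => ⟨?_, ?_⟩⟩
  · rintro v (hv | hv)
    · exact hP.left hxz.le hv
    · exact hP' x v Set.self_mem_Ici hxz.le hv
  · by_contra! h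
    exact (hP'' w y h.not_ge (h.trans hxz) hy).2 hw
  · by_contra! h
    exact (hP.right hy.le h).2 hw

theorem Preference.exists_peakedAt_left_first' (y : X) :
    ∃ P : Preference X, P.PeakedAt y ∧ ∀ x, x ≤ y → ∀ w, P.weak w x → x ≤ w ∧ w ≤ y := by
  obtain ⟨P, hP, hP'⟩ := exists_peakedAt_left_first y
  refine ⟨P, hP, fun x hx w hw => ⟨?_, ?_⟩⟩ <;> by_contra! h
  · exact (hP.left hx h).2 hw
  · exact (hP' x w hx h).2 hw

variable {N : Type*} {A : Set N} {f : PrefDomain X A → X}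

/-- Closedness provides a nearest element of `Ω` on each side of the unrestricted peak that meets
`Ω`; the better of these candidates is the restricted peak. -/
theorem exists_isRestrictedPeak {Ω : Set X} (hne : Ω.Nonempty)
    (hΩ : IsClosed (Subtype.val '' Ω : Set ℝ)) {R : Preference X} (hR : R.SinglePeaked) :
    ∃ p, IsRestrictedPeak Ω R p := by
  obtain ⟨ρ, hρ⟩ := hR
  have hl : (∃ a ∈ Ω, a ≤ ρ) → ∃ a ∈ Ω, a ≤ ρ ∧ ∀ y ∈ Ω, y ≤ ρ → y ≤ a := by
    rintro ⟨a, ha, haρ⟩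
    obtain ⟨⟨b, hb, hbe⟩, hbρ⟩ := (hΩ.inter isClosed_Iic).csSup_mem
      (⟨a, ⟨a, ha, rfl⟩, haρ⟩ : ((Subtype.val '' Ω : Set ℝ) ∩ Set.Iic (ρ : ℝ)).Nonempty)
      ⟨ρ, fun _ h => h.2⟩
    refine ⟨b, hb, by rw [← hbe] at hbρ; exact hbρ, fun y hy hyρ => ?_⟩
    have := le_csSup (s := (Subtype.val '' Ω : Set ℝ) ∩ Set.Iic (ρ : ℝ)) ⟨(ρ : ℝ), fun _ h => h.2⟩
      (⟨⟨y, hy, rfl⟩, hyρ⟩ : (y : ℝ) ∈ (Subtype.val '' Ω : Set ℝ) ∩ Set.Iic (ρ : ℝ))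
    rw [← hbe] at this
    exact this
  have hr : (∃ a ∈ Ω, ρ ≤ a) → ∃ a ∈ Ω, ρ ≤ a ∧ ∀ y ∈ Ω, ρ ≤ y → a ≤ y := by
    rintro ⟨a, ha, haρ⟩
    obtain ⟨⟨b, hb, hbe⟩, hbρ⟩ := (hΩ.inter isClosed_Ici).csInf_mem
      (⟨a, ⟨a, ha, rfl⟩, haρ⟩ : ((Subtype.val '' Ω : Set ℝ) ∩ Set.Ici (ρ : ℝ)).Nonempty)
      ⟨ρ, fun _ h => h.2⟩
    refine ⟨b, hb, by rw [← hbe] at hbρ; exact hbρ, fun y hy hyρ => ?_⟩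
    have := csInf_le (s := (Subtype.val '' Ω : Set ℝ) ∩ Set.Ici (ρ : ℝ)) ⟨(ρ : ℝ), fun _ h => h.2⟩
      (⟨⟨y, hy, rfl⟩, hyρ⟩ : (y : ℝ) ∈ (Subtype.val '' Ω : Set ℝ) ∩ Set.Ici (ρ : ℝ))
    rw [← hbe] at this
    exact this
  have hbest : ∀ a, a ≤ ρ → (∀ y ∈ Ω, y ≤ ρ → y ≤ a) → ∀ y ∈ Ω, y ≤ ρ → y ≠ a → R.strict a y :=
    fun a ha hmax y hy hyρ hne => hρ _ _ (.inl ⟨ha, lt_of_le_of_ne (hmax y hy hyρ) hne⟩)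
  have hbest' : ∀ a, ρ ≤ a → (∀ y ∈ Ω, ρ ≤ y → a ≤ y) → ∀ y ∈ Ω, ρ ≤ y → y ≠ a → R.strict a y :=
    fun a ha hmin y hy hyρ hne => hρ _ _ (.inr ⟨ha, lt_of_le_of_ne (hmin y hy hyρ) hne.symm⟩)
  by_cases h1 : ∃ a ∈ Ω, a ≤ ρ <;> by_cases h2 : ∃ a ∈ Ω, ρ ≤ a
  · obtain ⟨a, ha, haρ, hmax⟩ := hl h1
    obtain ⟨b, hb, hbρ, hmin⟩ := hr h2
    rcases R.complete a b with h | h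
    · refine ⟨a, ha, fun y hy hya => ?_⟩
      rcases le_total y ρ with hyρ | hyρ
      · exact hbest a haρ hmax y hy hyρ hya
      · rcases eq_or_ne y b with rfl | hyb
        · exact strict_of_weak_of_ne h hya.symm
        · exact weak.trans_strict h (hbest' b hbρ hmin y hy hyρ hyb)
    · refine ⟨b, hb, fun y hy hyb => ?_⟩
      rcases le_total y ρ with hyρ | hyρ
      · rcases eq_or_ne y a with rfl | hya
        · exact strict_of_weak_of_ne h hyb.symm
        · exact weak.trans_strict h (hbest a haρ hmax y hy hyρ hya)
      · exact hbest' b hbρ hmin y hy hyρ hyb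
  · obtain ⟨a, ha, haρ, hmax⟩ := hl h1
    exact ⟨a, ha, fun y hy => hbest a haρ hmax y hy
      ((le_total y ρ).resolve_right fun h => h2 ⟨y, hy, h⟩)⟩
  · obtain ⟨b, hb, hbρ, hmin⟩ := hr h2
    exact ⟨b, hb, fun y hy => hbest' b hbρ hmin y hy
      ((le_total y ρ).resolve_left fun h => h1 ⟨y, hy, h⟩)⟩
  · obtain ⟨a, ha⟩ := hne
    exact ((le_total a ρ).elim (fun h => h1 ⟨a, ha, h⟩) fun h => h2 ⟨a, ha, h⟩).elim

theorem exists_isPeakVector (hΩ : IsClosed (Subtype.val '' Set.range f : Set ℝ))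
    (R : PrefDomain X A) : ∃ p : A → Set.range f, IsPeakVector (Set.range f) R p := by
  choose p hp using fun i : A =>
    exists_isRestrictedPeak (Ω := Set.range f) ⟨f R, R, rfl⟩ hΩ (R.singlePeaked i.2)
  exact ⟨fun i => ⟨p i, (hp i).1⟩, hp⟩

theorem exists_profile_of_peaks {Ω : Set X} (p : A → Ω) (R : PrefDomain X A) :
    ∃ R' : PrefDomain X A, IsPeakVector Ω R' p ∧ ∀ i ∉ A, R'.pref i = R.pref i := by
  choose P hP _ using fun z : X => exists_peakedAt_left_first z
  refine ⟨⟨fun i => open Classical in if h : i ∈ A then P (p ⟨i, h⟩) else R.1 i, fun i hi => ?_,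
    fun i hi => ?_⟩, fun i => ?_, fun i hi => dif_neg hi⟩
  · simp only [dif_pos hi]; exact (hP _).singlePeaked
  · simp only [dif_neg hi]; exact R.2.2 i hi
  · have : IsRestrictedPeak Ω (P (p i)) (p i) := (hP _).isRestrictedPeak (p i).2
    simpa only [pref, dif_pos i.2] using this

variable [Finite N]

/-- Let `x < z < y` be the three outcomes. The supporters of `x` in `A` get peak `z`, those of `y`
get peak `y`, and `x` and `y` remain outcomes. Now move all dips to `z` (profile `V`): an outcome
above `z` would yield to `x`, and the outcome `z`, worst for the single-dipped agents, would yield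
to `y`. So the outcome is below `z`. But the supporters of `y` could then take peak `z` as well and
obtain `z` by unanimity, a gain for them. -/
theorem StrategyProof.not_between (hf : StrategyProof f) {R R' Rz : PrefDomain X A}
    (h : ∀ i ∈ A, R'.pref i = R.pref i) (hx : f R < f Rz) (hy : f Rz < f R') : False := by
  set x := f R with hfR
  set y := f R' with hfR'
  set z := f Rz with hfz
  obtain ⟨P, hP, hPx, hPy⟩ := exists_peakedAt_cut hx
  obtain ⟨Y, hY, hYx⟩ := exists_peakedAt_left_first' y
  obtain ⟨T, hT, hT'⟩ := exists_dippedAt_left_first z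
  let GP : PrefDomain X A := glue (fun _ => P) (fun _ => T) (fun _ => hP.singlePeaked)
    fun _ => hT.singleDipped
  let GY : PrefDomain X A := glue (fun _ => Y) (fun _ => T) (fun _ => hY.singlePeaked)
    fun _ => hT.singleDipped
  have hxy : x < y := hx.trans hy
  let A₁ : Set N := {i | i ∈ A ∧ (R.pref i).strict x y}
  let A₂ : Set N := {i | i ∈ A ∧ (R.pref i).strict y x}
  have hA : ∀ i ∈ A, i ∉ A₂ → i ∈ A₁ := fun i hi hi2 =>
    ⟨hi, (strict_or_strict hxy.ne).resolve_right fun h => hi2 ⟨hi, h⟩⟩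
  have hA12 : ∀ i ∈ A₁, i ∉ A₂ := fun i hi hi2 => hi.2.asymm hi2.2
  let E₃ := mix A₂ GY (mix A₁ GP R')
  have hE₃1 : ∀ i ∈ A₁, E₃.pref i = P := fun i hi => by
    rw [mix_notMem (hA12 i hi), mix_mem hi, glue_mem hi.1]
  have hE₃2 : ∀ i ∈ A₂, E₃.pref i = Y := fun i hi => by rw [mix_mem hi, glue_mem hi.1]
  have hE₃D : ∀ i ∉ A, E₃.pref i = R'.pref i := fun i hi => by
    rw [mix_notMem fun h => hi h.1, mix_notMem fun h => hi h.1]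
  have hfE₃ : f E₃ = y := by
    refine hf.monotone fun i => ?_
    by_cases hi : i ∈ A
    · right
      intro w hw
      by_cases hi2 : i ∈ A₂
      · rw [hE₃2 i hi2] at hw
        rw [Y.antisymm _ _ hw (hY.weak_top w)]
        exact weak_refl _ _
      · have hi1 := hA i hi hi2
        rw [hE₃1 i hi1] at hw
        rw [h i hi]
        exact (R.singlePeaked hi).weak_of_between hi1.2.1 (.inl (hPy y hy w hw))
    · exact .inl (hE₃D i hi)
  let E₁ := mix A₂ GY R
  have hfE₁ : f E₁ = x := by
    refine hf.monotone fun i => ?_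
    by_cases hi : i ∈ A₂
    · right
      intro w hw
      rw [mix_mem hi, glue_mem hi.1] at hw
      exact (R.singlePeaked hi.1).weak_of_between hi.2.1 (.inr (hYx x hxy.le w hw))
    · exact .inl (mix_notMem hi)
  let V := mix A E₃ GP
  have hVA : ∀ i ∈ A, V.pref i = E₃.pref i := fun i hi => mix_mem hi
  have hVD : ∀ i ∉ A, V.pref i = T := fun i hi => by rw [mix_notMem hi, glue_notMem hi]
  have h1 : f V ≤ z := by
    by_contra! hv
    have : f E₁ = f V := hf.eq_of_weak fun i => by
      by_cases hi : i ∈ A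
      · by_cases hi2 : i ∈ A₂
        · left; rw [hVA i hi, hE₃2 i hi2, mix_mem hi2, glue_mem hi]
        · right
          rw [hVA i hi, hE₃1 i (hA i hi hi2), hfE₁]
          exact (hPx _ (.inr hv)).1
      · right
        rw [hVD i hi, hfE₁]
        exact (hT' _ _ hx hv.le).1
    exact (hx.trans hv).ne (hfE₁.symm.trans this)
  have h2 : f V ≠ z := by
    intro hv
    have : f E₃ = f V := hf.eq_of_weak fun i => by
      by_cases hi : i ∈ A
      · exact .inl (hVA i hi).symm
      · right; rw [hVD i hi, hv]; exact hT.weak_bot _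
    exact hy.ne' (hfE₃.symm.trans (this.trans hv))
  let V' := mix A₂ GP V
  have hV' : ∀ i ∈ A, V'.pref i = P := fun i hi => by
    by_cases hi2 : i ∈ A₂
    · rw [mix_mem hi2, glue_mem hi]
    · rw [mix_notMem hi2, hVA i hi, hE₃1 i (hA i hi hi2)]
  have hfV' : f V' = z := hf.eq_of_peaks (Rz := Rz) (fun i hi => by
    rw [hV' i hi]; exact hP.isRestrictedPeak ⟨Rz, rfl⟩) hx hfz.symm hy
  refine h2 ((hf.eq_of_weak fun i => ?_ : f V' = f V).symm.trans hfV')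
  by_cases hi : i ∈ A₂
  · right
    rw [hVA i hi.1, hE₃2 i hi, hfV']
    exact (hY.left hy.le (lt_of_le_of_ne h1 h2)).1
  · exact .inl (mix_notMem hi)

/-- A rise must jump over `z`, or `i₀` would manipulate. The construction of `not_between` then
applies with `i₀` in the role of the single-dipped agents. It yields outcome `z` at `V`, a profile
that `i₀` can reach from `E₃`, where the outcome is `y`. -/
theorem StrategyProof.not_lt_of_peak_eq (hf : StrategyProof f) {R R' : PrefDomain X A} {i₀ : N}
    (hi₀ : i₀ ∈ A) (h : ∀ j, j ≠ i₀ → R'.pref j = R.pref j) {z : X}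
    (hz : IsRestrictedPeak (Set.range f) (R.pref i₀) z)
    (hz' : IsRestrictedPeak (Set.range f) (R'.pref i₀) z) : ¬ f R < f R' := by
  intro hxy
  obtain ⟨Rz, hfz⟩ := hz.1
  set x := f R with hfR
  set y := f R' with hfR'
  have hx : x < z := by
    by_contra! hle
    have h1 := hz'.right (R'.singlePeaked hi₀) ⟨R', rfl⟩ hle hxy
    exact h1.2 (hf R' R i₀ fun j hj => (h j hj).symm)
  have hy : z < y := by
    by_contra! hle
    have h1 := hz.left (R.singlePeaked hi₀) ⟨R, rfl⟩ hle hxy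
    exact h1.2 (hf R R' i₀ h)
  obtain ⟨P, hP, hPx, hPy⟩ := exists_peakedAt_cut hx
  obtain ⟨Y, hY, hYx⟩ := exists_peakedAt_left_first' y
  obtain ⟨T, hT, -⟩ := exists_dippedAt_left_first z
  let GP : PrefDomain X A := glue (fun _ => P) (fun _ => T) (fun _ => hP.singlePeaked)
    fun _ => hT.singleDipped
  let GY : PrefDomain X A := glue (fun _ => Y) (fun _ => T) (fun _ => hY.singlePeaked)
    fun _ => hT.singleDipped
  let A₁ : Set N := {i | i ≠ i₀ ∧ i ∈ A ∧ (R.pref i).strict x y}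
  let A₂ : Set N := {i | i ≠ i₀ ∧ i ∈ A ∧ (R.pref i).strict y x}
  have hA : ∀ i ∈ A, i ≠ i₀ → i ∉ A₂ → i ∈ A₁ := fun i hi hi0 hi2 =>
    ⟨hi0, hi, (strict_or_strict hxy.ne).resolve_right fun h => hi2 ⟨hi0, hi, h⟩⟩
  have hA12 : ∀ i ∈ A₁, i ∉ A₂ := fun i hi hi2 => hi.2.2.asymm hi2.2.2
  let E₃ := mix A₂ GY (mix A₁ GP R')
  have hE₃1 : ∀ i ∈ A₁, E₃.pref i = P := fun i hi => by
    rw [mix_notMem (hA12 i hi), mix_mem hi, glue_mem hi.2.1]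
  have hE₃2 : ∀ i ∈ A₂, E₃.pref i = Y := fun i hi => by rw [mix_mem hi, glue_mem hi.2.1]
  have hE₃o : ∀ i, i ∉ A₁ → i ∉ A₂ → E₃.pref i = R'.pref i := fun i hi1 hi2 => by
    rw [mix_notMem hi2, mix_notMem hi1]
  have hE₃0 : E₃.pref i₀ = R'.pref i₀ := hE₃o _ (fun h => h.1 rfl) fun h => h.1 rfl
  have hfE₃ : f E₃ = y := by
    refine hf.monotone fun i => ?_
    by_cases hi2 : i ∈ A₂
    · right
      intro w hw
      rw [hE₃2 i hi2] at hw
      rw [Y.antisymm _ _ hw (hY.weak_top w)]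
      exact weak_refl _ _
    by_cases hi1 : i ∈ A₁
    · right
      intro w hw
      rw [hE₃1 i hi1] at hw
      rw [h i hi1.1]
      exact (R.singlePeaked hi1.2.1).weak_of_between hi1.2.2.1 (.inl (hPy y hy w hw))
    · exact .inl (hE₃o i hi1 hi2)
  let E₁ := mix A₂ GY R
  have hfE₁ : f E₁ = x := by
    refine hf.monotone fun i => ?_
    by_cases hi : i ∈ A₂
    · right
      intro w hw
      rw [mix_mem hi, glue_mem hi.2.1] at hw
      exact (R.singlePeaked hi.2.1).weak_of_between hi.2.2.1 (.inr (hYx x hxy.le w hw))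
    · exact .inl (mix_notMem hi)
  let V := mix {i₀} R E₃
  have hV0 : V.pref i₀ = R.pref i₀ := mix_mem rfl
  have hV : ∀ i, i ≠ i₀ → V.pref i = E₃.pref i := fun i hi => mix_notMem hi
  have h1 : f V ≤ z := by
    by_contra! hv
    have : f E₁ = f V := hf.eq_of_weak fun i => by
      by_cases hi0 : i = i₀
      · subst hi0; left; rw [hV0, mix_notMem fun h => h.1 rfl]
      rw [hV i hi0]
      by_cases hi2 : i ∈ A₂
      · left; rw [hE₃2 i hi2, mix_mem hi2, glue_mem hi2.2.1]
      by_cases hi1 : i ∈ A₁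
      · right
        rw [hE₃1 i hi1, hfE₁]
        exact (hPx _ (.inr hv)).1
      · left; rw [hE₃o i hi1 hi2, mix_notMem hi2, h i hi0]
    exact (hx.trans hv).ne (hfE₁.symm.trans this)
  let V' := mix A₂ GP V
  have hV' : ∀ i ∈ A, IsRestrictedPeak (Set.range f) (V'.pref i) z := fun i hi => by
    by_cases hi0 : i = i₀
    · subst hi0; rw [mix_notMem fun h => h.1 rfl, hV0]; exact hz
    have : V'.pref i = P := by
      by_cases hi2 : i ∈ A₂
      · rw [mix_mem hi2, glue_mem hi]
      · rw [mix_notMem hi2, hV i hi0, hE₃1 i (hA i hi hi0 hi2)]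
    rw [this]
    exact hP.isRestrictedPeak hz.1
  have hfV' : f V' = z := hf.eq_of_peaks hV' hx hfz hy
  have hfV : f V = z := by
    rw [← hfV']
    refine (hf.eq_of_weak fun i => ?_).symm
    by_cases hi : i ∈ A₂
    · right
      rw [hV i hi.1, hE₃2 i hi, hfV']
      rcases h1.eq_or_lt with h1 | h1
      · rw [h1]; exact weak_refl _ _
      · exact (hY.left hy.le h1).1
    · exact .inl (mix_notMem hi)
  have := hf E₃ V i₀ hV
  rw [hfE₃, hfV, hE₃0] at this
  exact (hz'.2 y ⟨R', rfl⟩ hy.ne').2 this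

/-- The outcome depends only on the restricted peaks of the agents of `A` and on the preferences of
the other agents. -/
theorem StrategyProof.eq_of_peak_eq (hf : StrategyProof f) {R R' : PrefDomain X A}
    (hD : ∀ i ∉ A, R'.pref i = R.pref i)
    (hA : ∀ i ∈ A, ∃ z, IsRestrictedPeak (Set.range f) (R.pref i) z ∧
      IsRestrictedPeak (Set.range f) (R'.pref i) z) : f R' = f R := by
  have key : ∀ S : Set N, S.Finite → f (mix S R' R) = f R := by
    intro S hS
    induction S, hS using Set.Finite.induction_on with
    | empty => exact congrArg f (ext' fun i => mix_notMem (Set.notMem_empty i))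
    | @insert a S ha _ ih =>
      have hoff : ∀ j, j ≠ a → (mix (insert a S) R' R).pref j = (mix S R' R).pref j := by
        intro j hj
        by_cases hjS : j ∈ S
        · rw [mix_mem hjS, mix_mem (Set.mem_insert_of_mem a hjS)]
        · rw [mix_notMem hjS, mix_notMem (by simp [hj, hjS])]
      have h1 : (mix S R' R).pref a = R.pref a := mix_notMem ha
      have h2 : (mix (insert a S) R' R).pref a = R'.pref a := mix_mem (Set.mem_insert _ _)
      rw [← ih]
      by_cases haA : a ∈ A
      · obtain ⟨z, hz, hz'⟩ := hA a haA
        rw [← h1] at hz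
        rw [← h2] at hz'
        exact le_antisymm (not_lt.1 (hf.not_lt_of_peak_eq haA hoff hz hz'))
          (not_lt.1 (hf.not_lt_of_peak_eq haA (fun j hj => (hoff j hj).symm) hz' hz))
      · refine congrArg f (ext' fun i => ?_)
        rcases eq_or_ne i a with rfl | hi
        · rw [h1, h2, hD i haA]
        · exact hoff i hi
  rw [← key Set.univ Set.finite_univ]
  exact congrArg f (ext' fun i => (mix_mem (Set.mem_univ i)).symm)

theorem StrategyProof.eq_of_isPeakVector (hf : StrategyProof f) {R R' : PrefDomain X A}
    {p : A → Set.range f} (h : IsPeakVector (Set.range f) R p)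
    (h' : IsPeakVector (Set.range f) R' p) (hD : ∀ i ∉ A, R'.pref i = R.pref i) : f R' = f R :=
  hf.eq_of_peak_eq hD fun i hi => ⟨_, h ⟨i, hi⟩, h' ⟨i, hi⟩⟩

/-- Two outcomes for the same restricted peaks are contiguous. -/
theorem StrategyProof.contiguous (hf : StrategyProof f) {R R' : PrefDomain X A}
    {p : A → Set.range f} (h : IsPeakVector (Set.range f) R p)
    (h' : IsPeakVector (Set.range f) R' p) (hlt : f R < f R') :
    Contiguous (Set.range f) (f R) (f R') := by
  refine ⟨⟨R, rfl⟩, ⟨R', rfl⟩, hlt, ?_⟩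
  rintro _ ⟨Rz, rfl⟩ ⟨h1, h2⟩
  have hM : f (mix A R R') = f R' := hf.eq_of_isPeakVector h'
    (fun i => by rw [mix_mem i.2]; exact h i) fun i hi => mix_notMem hi
  exact hf.not_between (R := R) (R' := mix A R R') (Rz := Rz) (fun i hi => mix_mem hi) h1
    (by rwa [hM])

/-- If the outcome is at most `x`, this remains true when no restricted peak that is at most `x`
moves to the right of `x`. -/
theorem StrategyProof.le_of_peaks_le (hf : StrategyProof f) {R R' : PrefDomain X A}
    (hD : ∀ i ∉ A, R'.pref i = R.pref i) {p q : A → Set.range f}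
    (hp : IsPeakVector (Set.range f) R p) (hq : IsPeakVector (Set.range f) R' q) {x : X}
    (hpq : ∀ i, (p i : X) ≤ x → (q i : X) ≤ x) (hx : f R ≤ x) : f R' ≤ x := by
  by_contra! hy
  choose PL hPL hPL' using fun z : X => exists_peakedAt_left_first z
  choose PR hPR hPR' using fun z : X => exists_peakedAt_right_first z
  classical
  obtain ⟨T, hT, -⟩ := exists_dippedAt_left_first x
  -- Since only restricted peaks matter, agents with new peak at most `x` may rank the left of that
  -- peak first, and those with new peak beyond `x` (hence old peak beyond `x`) may rank the right
  -- of the old peak first. The former keep the outcome of `V` at most `x`; the latter would gain by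
  -- moving to an outcome beyond `x`.
  let Gl : PrefDomain X A := PrefDomain.glue
    (fun i => if h : i ∈ A then PL (q ⟨i, h⟩) else PL x) (fun _ => T)
    (fun i => by split_ifs <;> exact (hPL _).singlePeaked) fun _ => hT.singleDipped
  let Gr : PrefDomain X A := PrefDomain.glue
    (fun i => if h : i ∈ A then PR (p ⟨i, h⟩) else PR x) (fun _ => T)
    (fun i => by split_ifs <;> exact (hPR _).singlePeaked) fun _ => hT.singleDipped
  have hGL : ∀ i (hi : i ∈ A), Gl.pref i = PL (q ⟨i, hi⟩) := fun i hi => by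
    rw [glue_mem hi, dif_pos hi]
  have hGR : ∀ i (hi : i ∈ A), Gr.pref i = PR (p ⟨i, hi⟩) := fun i hi => by
    rw [glue_mem hi, dif_pos hi]
  let B : Set N := {i | ∃ hi : i ∈ A, (q ⟨i, hi⟩ : X) ≤ x}
  let C : Set N := {i | ∃ hi : i ∈ A, x < (q ⟨i, hi⟩ : X)}
  have hBC : ∀ i ∈ A, i ∉ B → i ∈ C := fun i hi h => ⟨hi, not_le.1 fun h' => h ⟨hi, h'⟩⟩
  have hCB : ∀ i ∈ C, i ∉ B := fun i ⟨_, h⟩ ⟨_, h'⟩ => h.not_ge h'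
  let R₁ := mix C Gr R
  have hfR₁ : f R₁ = f R := by
    refine hf.eq_of_isPeakVector hp (fun i => ?_) fun i hi => mix_notMem fun h => hi h.1
    by_cases hi : (i : N) ∈ C
    · rw [mix_mem hi, hGR _ i.2]; exact (hPR _).isRestrictedPeak (p i).2
    · rw [mix_notMem hi]; exact hp i
  let R₃ := mix B Gl R'
  have hfR₃ : f R₃ = f R' := by
    refine hf.eq_of_isPeakVector hq (fun i => ?_) fun i hi => mix_notMem fun h => hi h.1
    by_cases hi : (i : N) ∈ B
    · rw [mix_mem hi, hGL _ i.2]; exact (hPL _).isRestrictedPeak (q i).2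
    · rw [mix_notMem hi]; exact hq i
  let V := mix B Gl R₁
  have h1 : f V ≤ x := by
    by_contra! hv
    have : f R₁ = f V := hf.eq_of_weak fun i => by
      by_cases hi : i ∈ B
      · right
        rw [mix_mem hi, hGL i hi.1, hfR₁]
        obtain ⟨hi, hle⟩ := hi
        rcases le_or_gt (f R) (q ⟨i, hi⟩) with h | h
        · exact (hPL' _ _ _ h (hle.trans_lt hv)).1
        · exact ((hPL _).right h.le (hx.trans_lt hv)).1
      · exact .inl (mix_notMem hi).symm
    exact (hx.trans_lt hv).ne (hfR₁.symm.trans this)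
  have : f R₃ = f V := hf.eq_of_weak fun i => by
    by_cases hi : i ∈ B
    · left; rw [mix_mem hi, mix_mem hi]
    by_cases hiA : i ∈ A
    · right
      have hiC := hBC i hiA hi
      rw [mix_notMem hi, mix_mem hiC, hGR i hiA, hfR₃]
      have hp' : x < p ⟨i, hiA⟩ := not_le.1 fun h => hi ⟨hiA, hpq _ h⟩
      rcases le_total (p ⟨i, hiA⟩ : X) (f R') with h | h
      · exact (hPR' _ _ _ (h1.trans_lt hp') h).1
      · exact ((hPR _).left h (h1.trans_lt hy)).1
    · left; rw [mix_notMem hi, mix_notMem hi, mix_notMem fun h => hiA h.1, hD i hiA]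
  rw [hfR₃] at this
  exact (h1.trans_lt hy).ne this.symm

end Peaks

/-! ### The order on step values; two-step rules are strategy-proof and type-anonymous. -/

section StepValues

open Preference PrefDomain

variable {X : Set ℝ} {Ω : Set X}

theorem Contiguous.le_or_le {x y z : X} (h : Contiguous Ω x y) (hz : z ∈ Ω) : z ≤ x ∨ y ≤ z := by
  by_contra! hcon
  exact h.2.2.2 z hz hcon

theorem Contiguous.le_of_lt {x y z : X} (h : Contiguous Ω x y) (hz : z ∈ Ω) (hzy : z < y) :
    z ≤ x := (h.le_or_le hz).resolve_right hzy.not_ge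

theorem Contiguous.ge_of_lt {x y z : X} (h : Contiguous Ω x y) (hz : z ∈ Ω) (hxz : x < z) :
    y ≤ z := (h.le_or_le hz).resolve_left hxz.not_ge

namespace StepValue

/-- The alternatives that occur in a step value. -/
def ends : StepValue X → Set X
  | .single x => {x}
  | .pair x y => {x, y}

theorem single_mem {x : X} (hx : x ∈ Ω) : single x ∈ stepValues Ω := .inl ⟨x, hx, rfl⟩

theorem pair_mem {x y : X} (h : Contiguous Ω x y) : pair x y ∈ stepValues Ω :=
  .inr ⟨x, y, h, rfl⟩

theorem contiguous_of_mem {x y : X} (h : pair x y ∈ stepValues Ω) : Contiguous Ω x y := by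
  rcases h with ⟨z, _, h⟩ | ⟨u, v, h, h'⟩
  · cases h
  · cases h'; exact h

theorem ends_subset {α : StepValue X} (hα : α ∈ stepValues Ω) : α.ends ⊆ Ω := by
  rcases hα with ⟨x, hx, rfl⟩ | ⟨x, y, h, rfl⟩
  · rintro _ rfl; exact hx
  · rintro _ (rfl | rfl)
    exacts [h.1, h.2.1]

theorem le_refl' (α : StepValue X) : α.le α := by
  cases α <;> simp [le]

theorem le_total' {α β : StepValue X} (hα : α ∈ stepValues Ω) (hβ : β ∈ stepValues Ω) :
    α.le β ∨ β.le α := by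
  rcases hα with ⟨x, hx, rfl⟩ | ⟨x, y, h, rfl⟩ <;> rcases hβ with ⟨u, hu, rfl⟩ | ⟨u, v, h', rfl⟩
  · exact le_total x u
  · exact h'.le_or_le hx
  · exact (h.le_or_le hu).symm
  · rcases lt_trichotomy x u with h1 | h1 | h1
    · exact .inl (.inr (h.ge_of_lt h'.1 h1))
    · subst h1
      exact .inl (.inl ⟨rfl, le_antisymm (h.ge_of_lt h'.2.1 h'.2.2.1)
        (h'.ge_of_lt h.2.1 h.2.2.1)⟩)
    · exact .inr (.inr (h'.ge_of_lt h.1 h1))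

theorem le_antisymm' {α β : StepValue X} (hα : α ∈ stepValues Ω) (hβ : β ∈ stepValues Ω)
    (h₁ : α.le β) (h₂ : β.le α) : α = β := by
  rcases hα with ⟨x, hx, rfl⟩ | ⟨x, y, h, rfl⟩ <;> rcases hβ with ⟨u, hu, rfl⟩ | ⟨u, v, h', rfl⟩
  · exact congrArg _ (le_antisymm (show x ≤ u from h₁) h₂)
  · exact absurd ((show v ≤ x from h₂).trans h₁) h'.2.2.1.not_ge
  · exact absurd ((show y ≤ u from h₁).trans h₂) h.2.2.1.not_ge
  · rcases h₁ with ⟨rfl, rfl⟩ | h₁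
    · rfl
    rcases h₂ with ⟨rfl, rfl⟩ | h₂
    · rfl
    exact absurd (h₂.trans (h.2.2.1.le.trans h₁)) h'.2.2.1.not_ge

theorem le_trans' {α β γ : StepValue X} (hα : α ∈ stepValues Ω) (hβ : β ∈ stepValues Ω)
    (hγ : γ ∈ stepValues Ω) (h₁ : α.le β) (h₂ : β.le γ) : α.le γ := by
  rcases hα with ⟨x, hx, rfl⟩ | ⟨x, y, h, rfl⟩ <;>
    rcases hβ with ⟨u, hu, rfl⟩ | ⟨u, v, h', rfl⟩ <;>
    rcases hγ with ⟨s, hs, rfl⟩ | ⟨s, t, h'', rfl⟩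
  · exact le_trans (show x ≤ u from h₁) h₂
  · exact le_trans (show x ≤ u from h₁) h₂
  · exact (show x ≤ u from h₁).trans (h'.2.2.1.le.trans h₂)
  · rcases h₂ with ⟨rfl, rfl⟩ | h₂
    · exact h₁
    · exact (show x ≤ u from h₁).trans (h'.2.2.1.le.trans h₂)
  · exact le_trans (show y ≤ u from h₁) h₂
  · exact .inr (le_trans (show y ≤ u from h₁) h₂)
  · rcases h₁ with ⟨rfl, rfl⟩ | h₁
    · exact h₂
    · exact (show y ≤ u from h₁).trans (h'.2.2.1.le.trans h₂)
  · rcases h₁ with ⟨rfl, rfl⟩ | h₁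
    · exact h₂
    · rcases h₂ with ⟨rfl, rfl⟩ | h₂
      · exact .inr h₁
      · exact .inr (h₁.trans (h'.2.2.1.le.trans h₂))

theorem lt_of_not_le {α β : StepValue X} (hα : α ∈ stepValues Ω) (hβ : β ∈ stepValues Ω)
    (h : ¬ α.le β) : β.lt α :=
  ⟨(le_total' hα hβ).resolve_left h, fun e => h (e ▸ le_refl' β)⟩

theorem not_le_of_lt {α β : StepValue X} (hα : α ∈ stepValues Ω) (hβ : β ∈ stepValues Ω)
    (h : α.lt β) : ¬ β.le α := fun h' => h.2 (le_antisymm' hα hβ h.1 h')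

theorem le_of_mem_ends {α β : StepValue X} (hα : α ∈ stepValues Ω) (hβ : β ∈ stepValues Ω)
    (h : α.lt β) {x y : X} (hx : x ∈ α.ends) (hy : y ∈ β.ends) : x ≤ y := by
  obtain ⟨h, hne⟩ := h
  rcases hα with ⟨a, ha, rfl⟩ | ⟨a, b, hab, rfl⟩ <;> rcases hβ with ⟨u, hu, rfl⟩ | ⟨u, v, huv, rfl⟩
  · cases hx; cases hy; exact h
  · cases hx
    rcases hy with rfl | rfl
    exacts [h, (show x ≤ _ from h).trans huv.2.2.1.le]
  · cases hy
    rcases hx with rfl | rfl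
    exacts [hab.2.2.1.le.trans h, h]
  · rcases h with ⟨rfl, rfl⟩ | h
    · exact (hne rfl).elim
    · have h1 : x ≤ b := by rcases hx with rfl | rfl; exacts [hab.2.2.1.le, le_rfl]
      have h2 : u ≤ y := by rcases hy with rfl | rfl; exacts [le_rfl, huv.2.2.1.le]
      exact h1.trans (h.trans h2)

end StepValue

/-- Between contiguous alternatives, the lower one is better if and only if the restricted peak is
not to its right. -/
theorem Contiguous.strict_iff {x y p : X} (h : Contiguous Ω x y) {R : Preference X}
    (hR : R.SinglePeaked) (hp : IsRestrictedPeak Ω R p) : R.strict x y ↔ p ≤ x := by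
  refine ⟨fun hxy => ?_, fun hpx => hp.right hR h.2.1 hpx h.2.2.1⟩
  by_contra! hlt
  exact hxy.asymm (hp.left hR h.1 (h.ge_of_lt hp.1 hlt) h.2.2.1)

variable {N : Type*} {A : Set N} {f : PrefDomain X A → X}

theorem finalOutcome_mem_ends (W : X → X → Set (Set N)) (R : PrefDomain X A) (α : StepValue X) :
    finalOutcome W R α ∈ α.ends := by
  cases α with
  | single x => rfl
  | pair x y =>
    change voting W x y R ∈ _
    unfold voting
    split_ifs
    exacts [.inl rfl, .inr rfl]

theorem voting_eq_left_iff {W : X → X → Set (Set N)} {R : PrefDomain X A} {x y : X} (h : x ≠ y) :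
    voting W x y R = x ↔ ∃ S ∈ W x y, S ⊆ {i | (R.pref i).strict x y} := by
  unfold voting
  split_ifs with h'
  exacts [iff_of_true rfl h', iff_of_false h.symm h']

variable {r : Set (StepValue X)} {L : StepValue X → Set (Set N)}
  {ω : (A → Set.range f) → StepValue X} {W : X → X → Set (Set N)}

theorem IsTwoStepRule.mem_stepValues (h : IsTwoStepRule f r L ω W) (p : A → Set.range f) :
    ω p ∈ stepValues (Set.range f) := h.range.subset (h.median p).1

theorem peaksUpTo_subset (p : A → Ω) (α : StepValue X) : peaksUpTo p α ⊆ A := fun _ hi => hi.1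

theorem IsTwoStepRule.peaksUpTo_mem (h : IsTwoStepRule f r L ω W) (p : A → Set.range f) :
    peaksUpTo p (ω p) ∈ L (ω p) := (((h.median p).2 _ (h.median p).1).1 rfl).1

theorem IsTwoStepRule.peaksUpTo_notMem (h : IsTwoStepRule f r L ω W) (p : A → Set.range f)
    {β : StepValue X} (hβ : β ∈ r) (hlt : β.lt (ω p)) : peaksUpTo p β ∉ L β :=
  (((h.median p).2 _ (h.median p).1).1 rfl).2 β hβ hlt

/-- With the first step unchanged the vote is binary and monotone, so a manipulator changes `ω` and
belongs to `A`. If the outcome rises, the peak `q` lies beyond `ω p`; the coalition that stopped the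
median at `ω p` is still there, so the median cannot rise. If the outcome falls, `q` lies below it
and the agent already counted at the relevant step values, so the median would have stopped earlier.
-/
theorem IsTwoStepRule.strategyProof (h : IsTwoStepRule f r L ω W)
    (hΩ : IsClosed (Subtype.val '' Set.range f : Set ℝ)) : StrategyProof f := by
  intro R R' i hoff
  by_contra hcon
  replace hcon := not_weak.1 hcon
  obtain ⟨p, hp⟩ := exists_isPeakVector hΩ R
  obtain ⟨p', hp'⟩ := exists_isPeakVector hΩ R'
  have hx := h.outcome R p hp
  have hy := h.outcome R' p' hp'
  have hxe : f R ∈ (ω p).ends := hx ▸ finalOutcome_mem_ends W R _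
  have hye : f R' ∈ (ω p').ends := hy ▸ finalOutcome_mem_ends W R' _
  have hα := h.mem_stepValues p
  have hα' := h.mem_stepValues p'
  have hpp : ∀ j : A, (j : N) ≠ i → p' j = p j := fun j hj =>
    Subtype.ext ((hp' j).unique (by rw [hoff j hj]; exact hp j))
  have hne : ω p ≠ ω p' := by
    intro he
    rw [← he] at hy hye
    cases hω : ω p with
    | single u =>
      rw [hω] at hx hy
      exact hcon.ne (hy.trans hx.symm)
    | pair u v =>
      rw [hω] at hx hy hxe hye hα
      have huv : u ≠ v := (StepValue.contiguous_of_mem hα).2.2.1.ne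
      rcases hxe with hxe | hxe <;> rcases hye with hye | hye
      · exact hcon.ne (hye.trans hxe.symm)
      · obtain ⟨S, hS, hST⟩ := (voting_eq_left_iff huv).1 (hx.symm.trans hxe)
        refine huv (((voting_eq_left_iff huv).2 ⟨S, hS, fun j hj => ?_⟩).symm.trans
          (hy.symm.trans hye))
        have hj' : (R.pref j).strict u v := hST hj
        rcases eq_or_ne j i with rfl | hji
        · rw [hye, hxe] at hcon; exact (hcon.asymm hj').elim
        · change (R'.pref j).strict u v
          rw [hoff j hji]; exact hj'
      · obtain ⟨S, hS, hST⟩ := (voting_eq_left_iff huv).1 (hy.symm.trans hye)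
        refine huv (((voting_eq_left_iff huv).2 ⟨S, hS, fun j hj => ?_⟩).symm.trans
          (hx.symm.trans hxe))
        have hj' : (R'.pref j).strict u v := hST hj
        rcases eq_or_ne j i with rfl | hji
        · rw [hye, hxe] at hcon; exact hcon
        · rw [hoff j hji] at hj'; exact hj'
      · exact hcon.ne (hye.trans hxe.symm)
  have hiA : i ∈ A := by
    by_contra hi
    exact hne (congrArg ω (funext fun j => (hpp j fun e => hi (e ▸ j.2)).symm))
  set q : X := (p ⟨i, hiA⟩ : X) with hq
  have hqp : IsRestrictedPeak (Set.range f) (R.pref i) q := hp ⟨i, hiA⟩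
  have hsp := R.singlePeaked hiA
  have hqs : StepValue.single q ∈ stepValues (Set.range f) := StepValue.single_mem hqp.1
  have hsub : ∀ β, ¬ (StepValue.single q).le β → peaksUpTo p β ⊆ peaksUpTo p' β := by
    rintro β hβ j ⟨hj, hjβ⟩
    refine ⟨hj, ?_⟩
    rcases eq_or_ne j i with rfl | hji
    · exact (hβ hjβ).elim
    · rw [hpp ⟨j, hj⟩ hji]; exact hjβ
  have hsub' : ∀ β, (StepValue.single q).le β → peaksUpTo p' β ⊆ peaksUpTo p β := by
    rintro β hβ j ⟨hj, hjβ⟩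
    refine ⟨hj, ?_⟩
    rcases eq_or_ne j i with rfl | hji
    · exact hβ
    · rw [← hpp ⟨j, hj⟩ hji]; exact hjβ
  rcases lt_or_gt_of_ne hcon.ne.symm with hlt | hlt
  · have hq : f R < q := by
      by_contra! hle
      exact hcon.asymm (hqp.right hsp ⟨R', rfl⟩ hle hlt)
    have hnle : ¬ (StepValue.single q).le (ω p) := by
      intro hle
      by_cases he : StepValue.single q = ω p
      · rw [← he] at hxe
        exact hq.ne hxe
      · exact hq.not_ge (StepValue.le_of_mem_ends hqs hα ⟨hle, he⟩ rfl hxe)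
    rcases StepValue.le_total' hα hα' with hle | hle
    · exact h.peaksUpTo_notMem p' (h.median p).1 ⟨hle, hne⟩
        (h.system.mono _ (h.median p).1 _ _ (h.peaksUpTo_mem p) (hsub _ hnle)
          (peaksUpTo_subset _ _))
    · exact hlt.not_ge (StepValue.le_of_mem_ends hα' hα ⟨hle, hne.symm⟩ hye hxe)
  · have hq : q < f R := by
      by_contra! hle
      exact hcon.asymm (hqp.left hsp ⟨R', rfl⟩ hle hlt)
    have hle : (ω p').le (ω p) := (StepValue.le_total' hα hα').resolve_left fun hle =>
      hlt.not_ge (StepValue.le_of_mem_ends hα hα' ⟨hle, hne⟩ hxe hye)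
    -- `γ` is the larger of `ω p'` and `q`. In the second case `q` is neither least (it is not below
    -- `ω p'`) nor greatest (it is below `f R`), so it belongs to `r`.
    obtain ⟨γ, hγ, hγα, hqγ, hαγ⟩ : ∃ γ ∈ r, γ.lt (ω p) ∧ (StepValue.single q).le γ ∧
        (ω p').le γ := by
      by_cases hqα : (StepValue.single q).le (ω p')
      · exact ⟨ω p', (h.median p').1, ⟨hle, hne.symm⟩, hqα, StepValue.le_refl' _⟩
      · have hαq := (StepValue.le_total' hqs hα').resolve_left hqα
        refine ⟨.single q, h.range.interior_mem q hqp.1 ?_ ?_, ?_, StepValue.le_refl' _, hαq⟩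
        · intro hmin
          refine hqα ?_
          rcases hα' with ⟨x, hx, he⟩ | ⟨x, y, hxy, he⟩
          · rw [he]; exact hmin.2 hx
          · rw [he]; exact hmin.2 hxy.1
        · intro hmax
          exact hq.not_ge (hmax.2 ⟨R, rfl⟩)
        · refine StepValue.lt_of_not_le hα hqs fun hle' => ?_
          by_cases he : ω p = StepValue.single q
          · rw [he] at hxe
            exact hq.ne hxe.symm
          · exact hq.not_ge (StepValue.le_of_mem_ends hα hqs ⟨hle', he⟩ hxe rfl)
    refine h.peaksUpTo_notMem p hγ hγα (h.system.mono _ hγ _ _ ?_ (hsub' γ hqγ)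
      (peaksUpTo_subset _ _))
    have hmem : peaksUpTo p' γ ∈ L (ω p') := by
      refine h.system.mono _ (h.median p').1 _ _ (h.peaksUpTo_mem p') ?_ (peaksUpTo_subset _ _)
      rintro j ⟨hj, hjα⟩
      exact ⟨hj, StepValue.le_trans' (StepValue.single_mem (p' ⟨j, hj⟩).2) hα'
        (h.range.subset hγ) hjα hαγ⟩
    by_cases he : ω p' = γ
    · rwa [he] at hmem
    · exact h.system.nested _ (h.median p').1 γ hγ ⟨hαγ, he⟩ _ hmem

/-- The peak vector permuted by a permutation that respects the types of the agents. -/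
def permutePeaks (p : A → Ω) (σ : Equiv.Perm N) (hσ : ∀ i, σ i ∈ A ↔ i ∈ A) : A → Ω :=
  fun i => p ⟨σ i, (hσ i).2 i.2⟩

theorem IsPeakVector.permute {R : PrefDomain X A} {p : A → Ω} (h : IsPeakVector Ω R p)
    (σ : Equiv.Perm N) (hσ : ∀ i, σ i ∈ A ↔ i ∈ A) :
    IsPeakVector Ω (R.permute σ hσ) (permutePeaks p σ hσ) :=
  fun i => h ⟨σ i, (hσ i).2 i.2⟩

theorem peaksUpTo_permutePeaks (p : A → Ω) (σ : Equiv.Perm N) (hσ : ∀ i, σ i ∈ A ↔ i ∈ A)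
    (α : StepValue X) : peaksUpTo (permutePeaks p σ hσ) α = {i | σ i ∈ peaksUpTo p α} :=
  Set.ext fun i => ⟨fun ⟨hi, h⟩ => ⟨(hσ i).2 hi, h⟩, fun ⟨hi, h⟩ => ⟨(hσ i).1 hi, h⟩⟩

theorem Equiv.Perm.ncard_setOf_mem (σ : Equiv.Perm N) (S : Set N) :
    {i | σ i ∈ S}.ncard = S.ncard := by
  have : {i | σ i ∈ S} = σ.symm '' S := by rw [Equiv.image_symm_eq_preimage]; rfl
  rw [this, Set.ncard_image_of_injective _ σ.symm.injective]

theorem Equiv.Perm.symm_mem_iff {σ : Equiv.Perm N} (hσ : ∀ i, σ i ∈ A ↔ i ∈ A) (i : N) :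
    σ.symm i ∈ A ↔ i ∈ A := by
  rw [← hσ, σ.apply_symm_apply]

theorem IsLeftDecisive.setOf_mem (h : IsLeftDecisive A r L W) {x y : X}
    (hxy : StepValue.pair x y ∈ r) {S : Set N} (hS : S ∈ W x y) (σ : Equiv.Perm N)
    (hσ : ∀ i, σ i ∈ A ↔ i ∈ A) : {i | σ i ∈ S} ∈ W x y := by
  refine h.anonymous x y hxy S hS _ ?_ ?_
  · rw [← σ.ncard_setOf_mem (S ∩ A)]
    exact congrArg _ (Set.ext fun i => and_congr_right fun _ => (hσ i).symm)
  · rw [← σ.ncard_setOf_mem (S ∩ Aᶜ)]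
    exact congrArg _ (Set.ext fun i => and_congr_right fun _ => not_congr (hσ i).symm)

theorem IsTwoStepRule.typeAnonymous (h : IsTwoStepRule f r L ω W)
    (hΩ : IsClosed (Subtype.val '' Set.range f : Set ℝ)) : TypeAnonymous f := by
  intro R σ hσ
  obtain ⟨p, hp⟩ := exists_isPeakVector hΩ R
  have hωr := (h.median p).1
  have hω : ω (permutePeaks p σ hσ) = ω p := by
    have hL : ∀ β ∈ r, peaksUpTo (permutePeaks p σ hσ) β ∈ L β ↔ peaksUpTo p β ∈ L β := by
      intro β hβ
      have hc : (peaksUpTo (permutePeaks p σ hσ) β).ncard = (peaksUpTo p β).ncard := by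
        rw [peaksUpTo_permutePeaks, σ.ncard_setOf_mem]
      exact ⟨fun hm => h.system.anonymous β hβ _ _ hm (peaksUpTo_subset _ _) hc.symm,
        fun hm => h.system.anonymous β hβ _ _ hm (peaksUpTo_subset _ _) hc⟩
    exact ((h.median _).2 _ hωr).2 ⟨(hL _ hωr).2 (h.peaksUpTo_mem p),
      fun β hβ hlt hm => h.peaksUpTo_notMem p hβ hlt ((hL β hβ).1 hm)⟩
  rw [h.outcome R p hp, h.outcome _ _ (hp.permute σ hσ), hω]
  cases hc : ω p with
  | single x => rfl
  | pair x y =>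
    rw [hc] at hωr
    have key : (∃ S ∈ W x y, S ⊆ {i | (R.pref i).strict x y}) ↔
        ∃ S ∈ W x y, S ⊆ {i | ((R.permute σ hσ).pref i).strict x y} := by
      constructor
      · rintro ⟨S, hS, hST⟩
        exact ⟨_, h.decisive.setOf_mem hωr hS σ hσ, fun i hi => hST hi⟩
      · rintro ⟨S, hS, hST⟩
        refine ⟨_, h.decisive.setOf_mem hωr hS σ.symm (Equiv.Perm.symm_mem_iff hσ),
          fun i hi => ?_⟩
        have : (R.pref (σ (σ.symm i))).strict x y := hST hi
        rwa [σ.apply_symm_apply] at this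
    change voting W x y R = voting W x y _
    unfold voting
    by_cases hk : ∃ S ∈ W x y, S ⊆ {i | (R.pref i).strict x y}
    · rw [if_pos hk, if_pos (key.1 hk)]
    · rw [if_neg hk, if_neg fun h => hk (key.2 h)]

/-- Sets that contain equally many agents of each type differ by a permutation that respects the
types. -/
theorem exists_perm_of_ncard_eq [Finite N] {S S' : Set N}
    (h : (S' ∩ A).ncard = (S ∩ A).ncard) (h' : (S' ∩ Aᶜ).ncard = (S ∩ Aᶜ).ncard) :
    ∃ σ : Equiv.Perm N, (∀ i, σ i ∈ A ↔ i ∈ A) ∧ ∀ i, σ i ∈ S ↔ i ∈ S' := by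
  classical
  -- Agents are coloured by type and membership. Equal counts make corresponding colour classes
  -- equinumerous, and the permutation is glued from bijections between them.
  let c : Set N → N → Bool × Bool := fun T i => (decide (i ∈ A), decide (i ∈ T))
  have hc : ∀ T i b, c T i = b ↔ (i ∈ A ↔ b.1 = true) ∧ (i ∈ T ↔ b.2 = true) := by
    rintro T i ⟨_ | _, _ | _⟩ <;> simp [c]
  have hcard : ∀ b, Nat.card {i // c S' i = b} = Nat.card {i // c S i = b} := by
    have hdiff : ∀ B : Set N, (S' ∩ B).ncard = (S ∩ B).ncard →
        (B \ S').ncard = (B \ S).ncard := by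
      intro B hB
      have h1 := Set.ncard_inter_add_ncard_sdiff_eq_ncard B S'
      have h2 := Set.ncard_inter_add_ncard_sdiff_eq_ncard B S
      rw [Set.inter_comm] at h1 h2
      omega
    have hset : ∀ T b, Nat.card {i // c T i = b} = {i | c T i = b}.ncard := fun T b =>
      Nat.card_coe_set_eq _
    have e1 : ∀ T, {i | c T i = (true, true)} = T ∩ A := fun T => by
      ext i; simp [hc, and_comm]
    have e2 : ∀ T, {i | c T i = (true, false)} = A \ T := fun T => by
      ext i; simp [hc]
    have e3 : ∀ T, {i | c T i = (false, true)} = T ∩ Aᶜ := fun T => by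
      ext i; simp [hc, and_comm]
    have e4 : ∀ T, {i | c T i = (false, false)} = Aᶜ \ T := fun T => by
      ext i; simp [hc]
    rintro ⟨_ | _, _ | _⟩ <;> rw [hset, hset]
    · rw [e4, e4]; exact hdiff _ h'
    · rw [e3, e3]; exact h'
    · rw [e2, e2]; exact hdiff _ h
    · rw [e1, e1]; exact h
  let e : ∀ b, {i // c S' i = b} ≃ {i // c S i = b} := fun b =>
    (Finite.equivFinOfCardEq (hcard b)).trans (Finite.equivFin _).symm
  let σ : Equiv.Perm N := (Equiv.sigmaFiberEquiv (c S')).symm.trans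
    ((Equiv.sigmaCongrRight e).trans (Equiv.sigmaFiberEquiv (c S)))
  have hσ : ∀ i, c S (σ i) = c S' i := fun i => (e (c S' i) ⟨i, rfl⟩).2
  exact ⟨σ, fun i => by simpa [c] using congrArg Prod.fst (hσ i),
    fun i => by simpa [c] using congrArg Prod.snd (hσ i)⟩

end StepValues

/-! ### From a strategy-proof, type-anonymous rule to the first step, the coalitions and the
decisive sets. -/

section Construction

open Preference PrefDomain

variable {N : Type*} {X : Set ℝ} {A : Set N} {f : PrefDomain X A → X}

/-- The outcomes at the profiles with restricted peaks `p`. -/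
def outcomes (f : PrefDomain X A → X) (p : A → Set.range f) : Set X :=
  {x | ∃ R, IsPeakVector (Set.range f) R p ∧ f R = x}

theorem outcomes_permutePeaks_subset (ht : TypeAnonymous f) (p : A → Set.range f)
    (σ : Equiv.Perm N) (hσ : ∀ i, σ i ∈ A ↔ i ∈ A) :
    outcomes f p ⊆ outcomes f (permutePeaks p σ hσ) := by
  rintro _ ⟨R, hR, rfl⟩
  exact ⟨R.permute σ hσ, hR.permute σ hσ, (ht R σ hσ).symm⟩

theorem outcomes_permutePeaks (ht : TypeAnonymous f) (p : A → Set.range f)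
    (σ : Equiv.Perm N) (hσ : ∀ i, σ i ∈ A ↔ i ∈ A) :
    outcomes f (permutePeaks p σ hσ) = outcomes f p := by
  refine (outcomes_permutePeaks_subset ht p σ hσ).antisymm' ?_
  have h := outcomes_permutePeaks_subset ht (permutePeaks p σ hσ) σ.symm
    (Equiv.Perm.symm_mem_iff hσ)
  have : permutePeaks (permutePeaks p σ hσ) σ.symm (Equiv.Perm.symm_mem_iff hσ) = p :=
    funext fun i => congrArg p (Subtype.ext (σ.apply_symm_apply i))
  rwa [this] at h

/-- `f` is described by the first step `ω`: the outcomes at the profiles with restricted peaks `p`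
are the alternatives that occur in `ω p`. -/
structure IsFirstStep (f : PrefDomain X A → X) (ω : (A → Set.range f) → StepValue X) : Prop where
  mem : ∀ p, ω p ∈ stepValues (Set.range f)
  ends : ∀ p, (ω p).ends = outcomes f p

theorem StepValue.eq_of_ends_eq {Ω : Set X} {α β : StepValue X} (hα : α ∈ stepValues Ω)
    (hβ : β ∈ stepValues Ω) (h : α.ends = β.ends) : α = β := by
  by_contra hne
  have key : ∀ {α β : StepValue X}, α ∈ stepValues Ω → β ∈ stepValues Ω → α.ends = β.ends →
      α ≠ β → ¬ α.le β := by
    intro α β hα hβ h hne hle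
    have hsub : ∀ x ∈ α.ends, ∀ y ∈ α.ends, x = y := fun x hx y hy =>
      le_antisymm (le_of_mem_ends hα hβ ⟨hle, hne⟩ hx (h ▸ hy))
        (le_of_mem_ends hα hβ ⟨hle, hne⟩ hy (h ▸ hx))
    have hsingle : ∀ {γ}, γ ∈ stepValues Ω → γ.ends = α.ends → ∃ x ∈ α.ends, γ = .single x := by
      rintro γ (⟨x, hx, rfl⟩ | ⟨x, y, hxy, rfl⟩) he
      · exact ⟨x, he ▸ rfl, rfl⟩
      · exact (hxy.2.2.1.ne (hsub x (he ▸ .inl rfl) y (he ▸ .inr rfl))).elim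
    obtain ⟨x, hx, rfl⟩ := hsingle hα rfl
    obtain ⟨y, hy, rfl⟩ := hsingle hβ h.symm
    exact hne (congrArg _ hy.symm)
  rcases le_total' hα hβ with hle | hle
  · exact key hα hβ h hne hle
  · exact key hβ hα h.symm (Ne.symm hne) hle

theorem StepValue.le_single_iff {Ω : Set X} {α : StepValue X} (hα : α ∈ stepValues Ω) (x : X) :
    α.le (.single x) ↔ ∀ v ∈ α.ends, v ≤ x := by
  rcases hα with ⟨y, hy, rfl⟩ | ⟨y, z, h, rfl⟩
  · exact ⟨fun h v hv => by cases hv; exact h, fun h => h y rfl⟩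
  · exact ⟨fun h' v hv => by
      rcases hv with rfl | rfl
      exacts [h.2.2.1.le.trans h', h'], fun h' => h' z (.inr rfl)⟩

/-- Together with `le_single_iff` this turns the order into thresholds on outcomes: every compatible
outcome counts at a single alternative, but one suffices at a pair. -/
theorem StepValue.le_pair_iff {Ω : Set X} {α : StepValue X} (hα : α ∈ stepValues Ω) {x y : X}
    (hxy : Contiguous Ω x y) : α.le (.pair x y) ↔ ∃ v ∈ α.ends, v ≤ x := by
  rcases hα with ⟨u, hu, rfl⟩ | ⟨u, v, h, rfl⟩
  · exact ⟨fun h => ⟨u, rfl, h⟩, fun ⟨w, hw, h⟩ => by cases hw; exact h⟩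
  · constructor
    · rintro (⟨rfl, rfl⟩ | h')
      exacts [⟨u, .inl rfl, le_rfl⟩, ⟨u, .inl rfl, h.2.2.1.le.trans h'⟩]
    · rintro ⟨w, hw, hwx⟩
      have hux : u ≤ x := by
        rcases hw with rfl | rfl
        exacts [hwx, h.2.2.1.le.trans hwx]
      rcases hux.eq_or_lt with rfl | hux
      · exact .inl ⟨rfl, le_antisymm (h.ge_of_lt hxy.2.1 hxy.2.2.1)
          (hxy.ge_of_lt h.2.1 h.2.2.1)⟩
      · exact .inr (h.ge_of_lt hxy.1 hux)

/-- Any two distinct outcomes with the same restricted peaks are contiguous, which leaves no room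
for a third. -/
theorem StrategyProof.exists_isFirstStep [Finite N] (hf : StrategyProof f) (R₀ : PrefDomain X A) :
    ∃ ω, IsFirstStep f ω := by
  have : ∀ p : A → Set.range f, ∃ α, α ∈ stepValues (Set.range f) ∧ α.ends = outcomes f p := by
    intro p
    obtain ⟨R, hR, -⟩ := exists_profile_of_peaks p R₀
    have hlt : ∀ R R', IsPeakVector (Set.range f) R p → IsPeakVector (Set.range f) R' p →
        f R < f R' → ∃ α, α ∈ stepValues (Set.range f) ∧ α.ends = outcomes f p := by
      intro R R' hR hR' h
      have hc := hf.contiguous hR hR' h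
      refine ⟨.pair (f R) (f R'), StepValue.pair_mem hc, Set.Subset.antisymm ?_ ?_⟩
      · rintro _ (rfl | rfl)
        exacts [⟨R, hR, rfl⟩, ⟨R', hR', rfl⟩]
      · rintro _ ⟨S, hS, rfl⟩
        rcases lt_trichotomy (f S) (f R) with h1 | h1 | h1
        · exact ((hf.contiguous hS hR' (h1.trans h)).2.2.2 _ ⟨R, rfl⟩ ⟨h1, h⟩).elim
        · exact .inl h1
        rcases lt_trichotomy (f S) (f R') with h2 | h2 | h2
        · exact (hc.2.2.2 _ ⟨S, rfl⟩ ⟨h1, h2⟩).elim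
        · exact .inr h2
        · exact ((hf.contiguous hR hS h1).2.2.2 _ ⟨R', rfl⟩ ⟨h, h2⟩).elim
    by_cases h : ∃ R', IsPeakVector (Set.range f) R' p ∧ f R' ≠ f R
    · obtain ⟨R', hR', hne⟩ := h
      rcases lt_or_gt_of_ne hne with h | h
      exacts [hlt _ _ hR' hR h, hlt _ _ hR hR' h]
    · push Not at h
      refine ⟨.single (f R), StepValue.single_mem ⟨R, rfl⟩, Set.Subset.antisymm ?_ ?_⟩
      · rintro _ rfl; exact ⟨R, hR, rfl⟩
      · rintro _ ⟨S, hS, rfl⟩; exact h S hS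
  choose ω h1 h2 using this
  exact ⟨ω, h1, h2⟩

theorem StepValue.exists_le {Ω : Set X} {α : StepValue X} (hα : α ∈ stepValues Ω) :
    ∃ x ∈ Ω, (StepValue.single x).le α := by
  rcases hα with ⟨x, hx, rfl⟩ | ⟨x, y, h, rfl⟩
  exacts [⟨x, hx, le_refl x⟩, ⟨x, h.1, le_refl x⟩]

theorem StepValue.exists_ge {Ω : Set X} {α : StepValue X} (hα : α ∈ stepValues Ω) :
    ∃ x ∈ Ω, α.le (.single x) := by
  rcases hα with ⟨x, hx, rfl⟩ | ⟨x, y, h, rfl⟩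
  exacts [⟨x, hx, le_refl x⟩, ⟨y, h.2.1, le_refl y⟩]

/-- The left coalition system of a first step: `S` is winning at `α` if the first step does not go
beyond `α` as soon as the agents of `S` have their peaks at or to the left of `α`. -/
def leftCoalitions (ω : (A → Set.range f) → StepValue X) (α : StepValue X) : Set (Set N) :=
  {S | α ∈ Set.range ω ∧ S ⊆ A ∧ ∀ p, S ⊆ peaksUpTo p α → (ω p).le α}

namespace IsFirstStep

variable {ω : (A → Set.range f) → StepValue X}

theorem apply_mem (hω : IsFirstStep f ω) {R : PrefDomain X A} {p : A → Set.range f}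
    (hR : IsPeakVector (Set.range f) R p) : f R ∈ (ω p).ends := by
  rw [hω.ends]; exact ⟨R, hR, rfl⟩

theorem permute (hω : IsFirstStep f ω) (ht : TypeAnonymous f) (p : A → Set.range f)
    (σ : Equiv.Perm N) (hσ : ∀ i, σ i ∈ A ↔ i ∈ A) : ω (permutePeaks p σ hσ) = ω p :=
  StepValue.eq_of_ends_eq (hω.mem _) (hω.mem _) (by
    rw [hω.ends, hω.ends, outcomes_permutePeaks ht])

/-- The median property, reduced to `le_of_peaks_le` at one threshold `x`. The preferences outside
`A` are held fixed: those of an arbitrary profile with peaks `q` at a single alternative, those of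
one witness with peaks `p` at a pair. -/
theorem le_of_subset (hω : IsFirstStep f ω) [Finite N] (hf : StrategyProof f) {p q : A → Set.range f} {α : StepValue X}
    (hα : α ∈ stepValues (Set.range f)) (hp : (ω p).le α)
    (hpq : peaksUpTo p α ⊆ peaksUpTo q α) : (ω q).le α := by
  rcases hα with ⟨x, hx, rfl⟩ | ⟨x, y, hxy, rfl⟩
  · rw [StepValue.le_single_iff (hω.mem _), hω.ends] at hp ⊢
    rintro _ ⟨R', hR', rfl⟩
    obtain ⟨R, hR, hD⟩ := exists_profile_of_peaks p R'
    exact hf.le_of_peaks_le (fun i hi => (hD i hi).symm) hR hR'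
      (fun i hi => (hpq ⟨i.2, hi⟩).2) (hp _ ⟨R, hR, rfl⟩)
  · rw [StepValue.le_pair_iff (hω.mem _) hxy, hω.ends] at hp ⊢
    obtain ⟨_, ⟨R, hR, rfl⟩, hle⟩ := hp
    obtain ⟨R', hR', hD⟩ := exists_profile_of_peaks q R
    exact ⟨_, ⟨R', hR', rfl⟩, hf.le_of_peaks_le hD hR hR' (fun i hi => (hpq ⟨i.2, hi⟩).2) hle⟩

theorem peaksUpTo_mem_iff (hω : IsFirstStep f ω) [Finite N] (hf : StrategyProof f) (p : A → Set.range f)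
    {α : StepValue X} (hα : α ∈ Set.range ω) :
    peaksUpTo p α ∈ leftCoalitions ω α ↔ (ω p).le α := by
  refine ⟨fun h => h.2.2 p subset_rfl, fun h => ⟨hα, peaksUpTo_subset _ _, fun q hq => ?_⟩⟩
  obtain ⟨q', rfl⟩ := hα
  exact hω.le_of_subset hf (hω.mem _) h hq

theorem isStepRange (hω : IsFirstStep f ω) [Finite N] (hf : StrategyProof f)
    (hΩ : IsClosed (Subtype.val '' Set.range f : Set ℝ)) :
    IsStepRange (Set.range f) (Set.range ω) where
  min_mem := by
    rintro _ ⟨⟨R, rfl⟩, hm⟩ h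
    obtain ⟨p, hp⟩ := exists_isPeakVector hΩ R
    have hmem := hω.apply_mem hp
    refine ⟨p, ?_⟩
    rcases hω.mem p with ⟨x, hx, he⟩ | ⟨x, y, hxy, he⟩
    · rw [he] at hmem ⊢
      cases hmem; rfl
    · rw [he] at hmem
      rcases hmem with hmem | hmem
      · subst hmem; exact (h y hxy ⟨p, he⟩).elim
      · exact ((hm hxy.1).not_gt (hmem ▸ hxy.2.2.1)).elim
  max_mem := by
    rintro _ ⟨⟨R, rfl⟩, hm⟩ h
    obtain ⟨p, hp⟩ := exists_isPeakVector hΩ R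
    have hmem := hω.apply_mem hp
    refine ⟨p, ?_⟩
    rcases hω.mem p with ⟨x, hx, he⟩ | ⟨x, y, hxy, he⟩
    · rw [he] at hmem ⊢
      cases hmem; rfl
    · rw [he] at hmem
      rcases hmem with hmem | hmem
      · exact ((hm hxy.2.1).not_gt (hmem ▸ hxy.2.2.1)).elim
      · replace hmem : f R = y := hmem
        subst hmem; exact (h x hxy ⟨p, he⟩).elim
  interior_mem := by
    rintro z hz hmin hmax
    obtain ⟨a, ⟨Ra, rfl⟩, ha⟩ : ∃ a ∈ Set.range f, a < z := by
      by_contra! h; exact hmin ⟨hz, h⟩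
    obtain ⟨c, ⟨Rc, rfl⟩, hc⟩ : ∃ c ∈ Set.range f, z < c := by
      by_contra! h; exact hmax ⟨hz, h⟩
    obtain ⟨Rz, hRz⟩ := hz
    let p : A → Set.range f := fun _ => ⟨z, Rz, hRz⟩
    have hends : ∀ v ∈ (ω p).ends, v = z := by
      rw [hω.ends]
      rintro _ ⟨R, hR, rfl⟩
      exact hf.eq_of_peaks (fun i hi => hR ⟨i, hi⟩) ha hRz hc
    refine ⟨p, ?_⟩
    rcases hω.mem p with ⟨x, hx, he⟩ | ⟨x, y, hxy, he⟩ <;> rw [he] at hends ⊢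
    · rw [hends x rfl]
    · exact (hxy.2.2.1.ne ((hends x (.inl rfl)).trans (hends y (.inr rfl)).symm)).elim
  subset := by
    rintro _ ⟨p, rfl⟩; exact hω.mem p

theorem isLeftCoalitionSystem (hω : IsFirstStep f ω) [Finite N] (hf : StrategyProof f) (ht : TypeAnonymous f)
    (hΩ : IsClosed (Subtype.val '' Set.range f : Set ℝ)) :
    IsLeftCoalitionSystem A (Set.range f) (Set.range ω) (leftCoalitions ω) where
  eq_empty α hα := Set.eq_empty_of_forall_notMem fun S hS => hα hS.1
  subset α _ S hS := hS.2.1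
  mono α hα S S' hS hSS' hS' := ⟨hα, hS', fun p hp => hS.2.2 p (hSS'.trans hp)⟩
  nested := by
    classical
    rintro _ ⟨p₁, rfl⟩ _ ⟨p₂, rfl⟩ hlt S ⟨hα, hSA, hS⟩
    refine ⟨⟨p₂, rfl⟩, hSA, fun p hp => ?_⟩
    obtain ⟨x, hx, hxα⟩ := StepValue.exists_le (hω.mem p₁)
    -- Moving the peaks of `S` down to `x` forces `ω q` to at most the smaller step value. Returning
    -- to `p` loses no agent at the larger one, where all of `S` already counts.
    let q : A → Set.range f := fun i => if (i : N) ∈ S then ⟨x, hx⟩ else p i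
    have hq : (ω q).le (ω p₁) := hS q fun i hi => ⟨hSA hi, by simpa only [q, if_pos hi] using hxα⟩
    refine hω.le_of_subset hf (hω.mem _)
      (StepValue.le_trans' (hω.mem _) (hω.mem _) (hω.mem _) hq hlt.1) ?_
    rintro i ⟨hi, hle⟩
    by_cases hiS : i ∈ S
    · exact hp hiS
    · exact ⟨hi, by simpa only [q, if_neg hiS] using hle⟩
  empty_of_no_max := by
    rintro hmax _ ⟨p, rfl⟩ hempty
    obtain ⟨b, hb, hle⟩ := StepValue.exists_ge (hω.mem p)
    refine hmax ⟨b, hb, ?_⟩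
    rintro _ ⟨R, rfl⟩
    obtain ⟨q, hq⟩ := exists_isPeakVector hΩ R
    exact (StepValue.le_single_iff (hω.mem q) b).1
      (StepValue.le_trans' (hω.mem _) (hω.mem _) (StepValue.single_mem hb)
        (hempty.2.2 q (Set.empty_subset _)) hle) _ (hω.apply_mem hq)
  empty_of_max := by
    intro m hm hmr
    obtain ⟨x, hxm, hxr⟩ : ∃ x, Contiguous (Set.range f) x m ∧ .pair x m ∈ Set.range ω := by
      by_contra! h
      exact hmr ((hω.isStepRange hf hΩ).max_mem m hm h)
    have hle : ∀ α ∈ Set.range ω, α.le (.pair x m) := by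
      rintro _ ⟨p, rfl⟩
      rcases hω.mem p with ⟨y, hy, he⟩ | ⟨u, v, huv, he⟩ <;> rw [he]
      · refine hxm.le_of_lt hy (lt_of_le_of_ne (hm.2 hy) ?_)
        rintro rfl
        exact hmr ⟨p, he⟩
      · exact (StepValue.le_pair_iff (StepValue.pair_mem huv) hxm).2
          ⟨u, .inl rfl, hxm.le_of_lt huv.1 (huv.2.2.1.trans_le (hm.2 huv.2.1))⟩
    refine ⟨_, hxr, hle, ⟨hxr, Set.empty_subset _, fun p _ => hle _ ⟨p, rfl⟩⟩, ?_⟩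
    intro α hα hne hempty
    obtain ⟨p₀, hp₀⟩ := hxr
    refine hne (StepValue.le_antisymm' ((hω.isStepRange hf hΩ).subset hα) (StepValue.pair_mem hxm)
      (hle α hα) ?_)
    rw [← hp₀]
    exact hempty.2.2 p₀ (Set.empty_subset _)
  anonymous := by
    rintro α hα S S' ⟨-, hSA, hS⟩ hSA' hcard
    refine ⟨hα, hSA', fun p hp => ?_⟩
    have hd : ∀ T : Set N, T ⊆ A → T ∩ Aᶜ = ∅ := fun T hT =>
      Set.eq_empty_of_forall_notMem fun i hi => hi.2 (hT hi.1)
    obtain ⟨σ, hσ, hσS⟩ := exists_perm_of_ncard_eq (A := A) (S := S') (S' := S)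
      (by rw [Set.inter_eq_left.2 hSA, Set.inter_eq_left.2 hSA', hcard])
      (by rw [hd _ hSA, hd _ hSA'])
    rw [← hω.permute ht p σ hσ]
    refine hS _ fun i hi => ?_
    rw [peaksUpTo_permutePeaks]
    exact hp ((hσS i).2 hi)

theorem isGeneralizedMedian (hω : IsFirstStep f ω) [Finite N] (hf : StrategyProof f) :
    IsGeneralizedMedian (Set.range ω) (leftCoalitions ω) ω := by
  refine fun p => ⟨⟨p, rfl⟩, fun α hα => ?_⟩
  have hαs : α ∈ stepValues (Set.range f) := by obtain ⟨q, rfl⟩ := hα; exact hω.mem q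
  rw [hω.peaksUpTo_mem_iff hf p hα]
  constructor
  · rintro rfl
    refine ⟨StepValue.le_refl' _, fun β hβ hlt hmem => ?_⟩
    have hβs : β ∈ stepValues (Set.range f) := by obtain ⟨q, rfl⟩ := hβ; exact hω.mem q
    exact StepValue.not_le_of_lt hβs hαs hlt ((hω.peaksUpTo_mem_iff hf p hβ).1 hmem)
  · rintro ⟨hle, hmin⟩
    by_contra hne
    exact hmin _ ⟨p, rfl⟩ ⟨hle, hne⟩
      ((hω.peaksUpTo_mem_iff hf p ⟨p, rfl⟩).2 (StepValue.le_refl' _))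

/-- At given restricted peaks, support for the lower outcome is decisive if it was so before. -/
theorem eq_left_of_strict (hω : IsFirstStep f ω) [Finite N] (hf : StrategyProof f) {p : A → Set.range f} {x y : X}
    (hp : ω p = .pair x y) {R R' : PrefDomain X A} (hR : IsPeakVector (Set.range f) R p)
    (hR' : IsPeakVector (Set.range f) R' p) (hx : f R = x)
    (h : ∀ i ∉ A, (R.pref i).strict x y → (R'.pref i).strict x y) : f R' = x := by
  have hxy : x ≠ y := (StepValue.contiguous_of_mem (hp ▸ hω.mem p)).2.2.1.ne
  have hends : ∀ S, IsPeakVector (Set.range f) S p → f S ≠ x → f S = y := fun S hS hne => by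
    have := hω.apply_mem hS
    rw [hp] at this
    exact this.resolve_left hne
  by_contra hne
  have hy := hends R' hR' hne
  let R₁ := mix A R R'
  have hR₁ : f R₁ = y := by
    rw [← hy]
    exact hf.eq_of_isPeakVector hR' (fun i => by rw [mix_mem i.2]; exact hR i)
      fun i hi => mix_notMem hi
  let B : Set N := {i | (R.pref i).strict x y}
  let M := mix B R R₁
  have hMA : ∀ i ∈ A, M.pref i = R.pref i := fun i hi => by
    by_cases hB : i ∈ B
    · exact mix_mem hB
    · exact (mix_notMem hB).trans (mix_mem hi)
  have hM : f M = x := by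
    by_contra hMx
    have hMy := hends M (fun i => by rw [hMA i i.2]; exact hR i) hMx
    refine hxy (hx.symm.trans ((hf.eq_of_weak fun i => ?_ : f M = f R).symm.trans hMy))
    by_cases hi : i ∈ A
    · exact .inl (hMA i hi)
    by_cases hB : i ∈ B
    · exact .inl (mix_mem hB)
    · right; rw [hMy, hx]; exact not_strict.1 hB
  refine hxy (hM.symm.trans ((hf.eq_of_weak fun i => ?_ : f M = f R₁).trans hR₁))
  by_cases hi : i ∈ A
  · exact .inl ((hMA i hi).trans (mix_mem hi).symm)
  by_cases hB : i ∈ B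
  · right
    rw [hM, hR₁, mix_notMem hi]
    exact (h i hi hB).1
  · exact .inl (mix_notMem hB)

end IsFirstStep

/-- The sets of agents whose support is sufficient for `x` against `y`. -/
def sufficientSets (ω : (A → Set.range f) → StepValue X) (x y : X) : Set (Set N) :=
  {T | ∃ R p, IsPeakVector (Set.range f) R p ∧ ω p = .pair x y ∧ f R = x ∧
    {i | (R.pref i).strict x y} ⊆ T}

/-- The left-decisive sets: the minimal sufficient sets. -/
def leftDecisiveSets (ω : (A → Set.range f) → StepValue X) (x y : X) : Set (Set N) :=
  {S | Minimal (· ∈ sufficientSets ω x y) S}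

theorem sufficientSets_mono {ω : (A → Set.range f) → StepValue X} {x y : X} {S T : Set N}
    (hS : S ∈ sufficientSets ω x y) (hST : S ⊆ T) : T ∈ sufficientSets ω x y := by
  obtain ⟨R, p, h1, h2, h3, h4⟩ := hS
  exact ⟨R, p, h1, h2, h3, h4.trans hST⟩

theorem exists_leftDecisive_subset [Finite N] {ω : (A → Set.range f) → StepValue X} {x y : X}
    {T : Set N} (hT : T ∈ sufficientSets ω x y) : ∃ S ∈ leftDecisiveSets ω x y, S ⊆ T := by
  obtain ⟨S, hS, hmin⟩ := (Set.toFinite (sufficientSets ω x y)).exists_le_minimal hT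
  exact ⟨S, hmin, hS⟩

namespace IsFirstStep

variable {ω : (A → Set.range f) → StepValue X}

/-- The profile witnessing sufficiency may have other peaks. Its supporters of `x` in `A` still have
peaks at most `x` under `p`, so moving to the peaks `p` keeps the outcome at most `x`, hence equal
to `x`. Adding supporters outside `A` then preserves it. -/
theorem eq_left_iff (hω : IsFirstStep f ω) [Finite N] (hf : StrategyProof f) {R : PrefDomain X A} {p : A → Set.range f}
    (hR : IsPeakVector (Set.range f) R p) {x y : X} (hp : ω p = .pair x y) :
    f R = x ↔ {i | (R.pref i).strict x y} ∈ sufficientSets ω x y := by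
  refine ⟨fun h => ⟨R, p, hR, hp, h, subset_rfl⟩, ?_⟩
  rintro ⟨R', p', hR', hp', hx, hsub⟩
  have hxy := StepValue.contiguous_of_mem (hp ▸ hω.mem p)
  obtain ⟨M, hM, hMD⟩ := exists_profile_of_peaks p R'
  have hle : f M ≤ x := by
    refine hf.le_of_peaks_le hMD hR' hM (fun i hi => ?_) hx.le
    exact (hxy.strict_iff (R.singlePeaked i.2) (hR i)).1
      (hsub ((hxy.strict_iff (R'.singlePeaked i.2) (hR' i)).2 hi))
  have hfM : f M = x := by
    have := hω.apply_mem hM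
    rw [hp] at this
    refine this.resolve_right fun h => ?_
    rw [show f M = y from h] at hle
    exact hxy.2.2.1.not_ge hle
  refine hω.eq_left_of_strict hf hp hM hR hfM fun i hi h => ?_
  rw [hMD i hi] at h
  exact hsub h

theorem setOf_mem_sufficientSets (hω : IsFirstStep f ω) (ht : TypeAnonymous f) {x y : X} {T : Set N}
    (hT : T ∈ sufficientSets ω x y) (σ : Equiv.Perm N) (hσ : ∀ i, σ i ∈ A ↔ i ∈ A) :
    {i | σ i ∈ T} ∈ sufficientSets ω x y := by
  obtain ⟨R, p, h1, h2, h3, h4⟩ := hT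
  exact ⟨R.permute σ hσ, permutePeaks p σ hσ, h1.permute σ hσ, by rw [hω.permute ht, h2],
    by rw [← ht, h3], fun i hi => h4 hi⟩

theorem exists_eq_of_mem_ends (hω : IsFirstStep f ω) {p : A → Set.range f} {x : X} (hx : x ∈ (ω p).ends) :
    ∃ R, IsPeakVector (Set.range f) R p ∧ f R = x := by
  rw [hω.ends] at hx; exact hx

theorem isLeftDecisive (hω : IsFirstStep f ω) [Finite N] (hf : StrategyProof f) (ht : TypeAnonymous f)
    (hΩ : IsClosed (Subtype.val '' Set.range f : Set ℝ)) :
    IsLeftDecisive A (Set.range ω) (leftCoalitions ω) (leftDecisiveSets ω) where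
  inter_dipped := by
    rintro x y - S ⟨⟨R, p, hR, hp, hx, hRS⟩, -⟩
    by_contra! hemp
    have hxy := StepValue.contiguous_of_mem (hp ▸ hω.mem p)
    -- If `x` won without any single-dipped supporter, it would win at every profile with peaks `p`,
    -- yet `y` is also an outcome there.
    obtain ⟨R', hR', hy⟩ := hω.exists_eq_of_mem_ends (p := p) (x := y)
      (by rw [hp]; exact .inr rfl)
    refine hxy.2.2.1.ne ((hω.eq_left_of_strict hf hp hR hR' hx fun i hi h => ?_).symm.trans hy)
    have : i ∈ S ∩ Aᶜ := ⟨hRS h, hi⟩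
    rw [hemp] at this
    exact this.elim
  inter_peaked := by
    classical
    rintro x y hr B ⟨⟨⟨-, hBA, hB⟩, hBx⟩, hBmin⟩
    have hxy : Contiguous (Set.range f) x y := by
      obtain ⟨p, hp⟩ := hr
      exact StepValue.contiguous_of_mem (hp ▸ hω.mem p)
    -- With exactly `B` at `x` and the rest at `y`, membership of `B` at the pair but not at `x`
    -- forces `ω p` to be the pair.
    let p : A → Set.range f := fun i => if (i : N) ∈ B then ⟨x, hxy.1⟩ else ⟨y, hxy.2.1⟩
    have hpB : peaksUpTo p (.single x) = B := by
      ext i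
      constructor
      · rintro ⟨hi, hle⟩
        by_contra hiB
        simp only [p, if_neg hiB] at hle
        exact hxy.2.2.1.not_ge hle
      · intro hi
        exact ⟨hBA hi, by simpa only [p, if_pos hi] using StepValue.le_refl' (.single x)⟩
    have hle : (ω p).le (.pair x y) := hB p hpB.ge
    have hnot : ¬ (ω p).le (.single x) := by
      intro hle'
      refine hBx (hpB ▸ (hω.peaksUpTo_mem_iff hf p ?_).2 hle')
      -- When `x` is not a value of `ω`, its collection is empty by convention and `B ∉ L(x)` says
      -- nothing. But then `x` is the least outcome, and `ω p ≤* x` would make `x` a value after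
      -- all.
      by_contra hxr
      have hends := (StepValue.le_single_iff (hω.mem p) x).1 hle'
      have hmin : IsLeast (Set.range f) x := by
        by_contra hmin
        exact hxr ((hω.isStepRange hf hΩ).interior_mem x hxy.1 hmin fun hmax =>
          (hmax.2 hxy.2.1).not_gt hxy.2.2.1)
      have heq : ∀ v ∈ (ω p).ends, v = x := fun v hv =>
        le_antisymm (hends v hv) (hmin.2 (StepValue.ends_subset (hω.mem p) hv))
      rcases hω.mem p with ⟨u, hu, he⟩ | ⟨u, v, huv, he⟩ <;> rw [he] at heq
      · exact hxr ⟨p, by rw [he, heq u rfl]⟩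
      · exact huv.2.2.1.ne ((heq u (.inl rfl)).trans (heq v (.inr rfl)).symm)
    have hp : ω p = .pair x y := by
      rcases hω.mem p with ⟨u, hu, he⟩ | ⟨u, v, huv, he⟩ <;> rw [he] at hle hnot ⊢
      · exact (hnot hle).elim
      · rcases hle with ⟨rfl, rfl⟩ | hle
        exacts [rfl, (hnot hle).elim]
    obtain ⟨R, hR, hx⟩ := hω.exists_eq_of_mem_ends (p := p) (x := x) (by rw [hp]; exact .inl rfl)
    obtain ⟨S, hS, hST⟩ := exists_leftDecisive_subset (T := B ∪ Aᶜ) (show _ ∈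
        sufficientSets ω x y from ⟨R, p, hR, hp, hx, fun i hi => by
      by_cases hiA : i ∈ A
      · refine .inl (hpB ▸ ⟨hiA, ?_⟩)
        exact (hxy.strict_iff (R.singlePeaked hiA) (hR ⟨i, hiA⟩)).1 hi
      · exact .inr hiA⟩)
    refine ⟨S, hS, Set.Subset.antisymm (fun i hi => (hST hi.1).resolve_right fun h => h hi.2) ?_⟩
    obtain ⟨R', p', hR', hp', hx', hRS⟩ := hS.1
    -- The agents with peaks up to the pair at the profile witnessing `S` form a coalition winning
    -- at the pair but not at `x`, and contained in `B`. Minimality of `B` makes it all of `B`.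
    have hC : peaksUpTo p' (.pair x y) ⊆ S ∩ A := by
      rintro i ⟨hi, hle⟩
      exact ⟨hRS ((hxy.strict_iff (R'.singlePeaked hi) (hR' ⟨i, hi⟩)).2 hle), hi⟩
    refine (hBmin ⟨(hω.peaksUpTo_mem_iff hf p' hr).2 (hp' ▸ StepValue.le_refl' _), fun h => ?_⟩
      (hC.trans fun i hi => (hST hi.1).resolve_right fun h => h hi.2)).trans hC
    have h' := (hω.peaksUpTo_mem_iff hf p' h.1).1 h
    rw [hp'] at h'
    exact hxy.2.2.1.not_ge h'
  minimal := fun x y _ S hS S' hS' hlt => hlt.not_subset (hS.2 hS'.1 hlt.subset)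
  anonymous := by
    rintro x y - S ⟨hS, hSmin⟩ S' hA hD
    obtain ⟨σ, hσ, hσS⟩ := exists_perm_of_ncard_eq hA hD
    have e : {i | σ i ∈ S} = S' := Set.ext hσS
    refine ⟨e ▸ hω.setOf_mem_sufficientSets ht hS σ hσ, fun Q hQ hQS i hi => ?_⟩
    have h := hSmin (hω.setOf_mem_sufficientSets ht hQ σ.symm (Equiv.Perm.symm_mem_iff hσ))
      (fun j hj => by
        have : σ (σ.symm j) ∈ S := (hσS _).2 (hQS hj)
        rwa [σ.apply_symm_apply] at this) ((hσS i).2 hi)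
    have h' : σ.symm (σ i) ∈ Q := h
    rwa [σ.symm_apply_apply] at h'

theorem isTwoStepRule (hω : IsFirstStep f ω) [Finite N] (hf : StrategyProof f) (ht : TypeAnonymous f)
    (hΩ : IsClosed (Subtype.val '' Set.range f : Set ℝ)) :
    IsTwoStepRule f (Set.range ω) (leftCoalitions ω) ω (leftDecisiveSets ω) where
  range := hω.isStepRange hf hΩ
  system := hω.isLeftCoalitionSystem hf ht hΩ
  median := hω.isGeneralizedMedian hf
  decisive := hω.isLeftDecisive hf ht hΩ
  outcome := by
    intro R p hR
    have hmem := hω.apply_mem hR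
    cases hp : ω p with
    | single x => rw [hp] at hmem; exact hmem
    | pair x y =>
      rw [hp] at hmem
      have hne : x ≠ y := (StepValue.contiguous_of_mem (hp ▸ hω.mem p)).2.2.1.ne
      change f R = voting _ x y R
      have key : f R = x ↔ voting (leftDecisiveSets ω) x y R = x := by
        rw [hω.eq_left_iff hf hR hp, voting_eq_left_iff hne]
        exact ⟨exists_leftDecisive_subset, fun ⟨S, hS, h⟩ => sufficientSets_mono hS.1 h⟩
      rcases hmem with h | h
      · rw [h, key.1 h]
      · have h1 : f R ≠ x := fun h' => hne (h'.symm.trans h)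
        have h2 : voting (leftDecisiveSets ω) x y R ∈ (StepValue.pair x y).ends :=
          finalOutcome_mem_ends _ R (.pair x y)
        exact h.trans (h2.resolve_left fun h' => h1 (key.2 h')).symm

end IsFirstStep

end Construction

theorem theorem2 {N : Type*} [Finite N] (X : Set ℝ) (hX : X.Nonempty) (A : Set N)
    (f : PrefDomain X A → X) (hf : IsClosed (Subtype.val '' Set.range f : Set ℝ)) :
    List.TFAE [
      StrategyProof f ∧ TypeAnonymous f,
      GroupStrategyProof f ∧ TypeAnonymous f,
      ∃ (r : Set (StepValue X)) (L : StepValue X → Set (Set N))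
        (ω : (A → Set.range f) → StepValue X) (W : X → X → Set (Set N)),
        IsTwoStepRule f r L ω W] ∧
    (StrategyProof f ∧ TypeAnonymous f →
      ∃ (r : Set (StepValue X)) (L : StepValue X → Set (Set N))
        (ω : (A → Set.range f) → StepValue X) (W : X → X → Set (Set N)),
        IsTwoStepRule f r L ω W ∧ Set.range ω = r) := by
  have main : StrategyProof f ∧ TypeAnonymous f →
      ∃ (r : Set (StepValue X)) (L : StepValue X → Set (Set N))
        (ω : (A → Set.range f) → StepValue X) (W : X → X → Set (Set N)),
        IsTwoStepRule f r L ω W ∧ Set.range ω = r := by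
    rintro ⟨hs, ht⟩
    obtain ⟨x, hx⟩ := hX
    obtain ⟨P, hP, -⟩ := Preference.exists_peakedAt_left_first (⟨x, hx⟩ : X)
    obtain ⟨Q, hQ, -⟩ := Preference.exists_dippedAt_left_first (⟨x, hx⟩ : X)
    obtain ⟨ω, hω⟩ := hs.exists_isFirstStep (PrefDomain.glue (fun _ => P) (fun _ => Q)
      (fun _ => hP.singlePeaked) fun _ => hQ.singleDipped)
    exact ⟨_, _, ω, _, hω.isTwoStepRule hs ht hf, rfl⟩
  refine ⟨?_, main⟩
  tfae_have 1 → 2 := fun h => ⟨h.1.groupStrategyProof, h.2⟩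
  tfae_have 2 → 1 := fun h => ⟨h.1.strategyProof, h.2⟩
  tfae_have 1 → 3 := fun h => by
    obtain ⟨r, L, ω, W, h, -⟩ := main h
    exact ⟨r, L, ω, W, h⟩
  tfae_have 3 → 1 := fun ⟨r, L, ω, W, h⟩ => ⟨h.strategyProof hf, h.typeAnonymous hf⟩
  tfae_finish
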